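/- **Conventions.** Graphs are finite; loops and multiple edges are allowed. A *cubic graph* is one in which every vertex has degree $3$ (a loop counts twice). A *connected plane cubic graph* is a connected cubic graph embedded in the plane (sphere), considered up to homeomorphism, i.e. a connected combinatorial map (rotation system) with $V-E+F=2$. An *isthmus* is an edge whose deletion disconnects the graph. A *coloring* of a cubic graph assigns to each edge one of the labels red, blue, purple so that three distinct labels occur at every vertex; a graph is *uncolorable* if it has no coloring. **Formations.** A formation for a cubic graph is the system of red and blue circuits given by a coloring of it: red curves run along the red and purple edges, blue curves along the blue and purple edges. Alternating curves run along the red and blue edges. By a *curve* of a formation we mean a red, a blue or an alternating curve. **Trails.** Let $G^*$ be a cubic graph with a distinguished edge $a$ (the *empty edge*) having two different end vertices. Let $G$ be obtained from $G^*$ by deleting $a$ and smoothing its two ends, which become interior points (the *endpoints of the empty edge*) of edges of $G$; circles without vertices may occur in $G$. A *trail* $T$ consists of such $G^*=G^*(T)$, $a$ and $G=G(T)$ together with a formation for $G(T)$ in which the two endpoints of the empty edge lie on blue edges and on two different blue curves (the *contextual curves*); the other curves form the trail structure. The trail is *non-empty* if its formation contains a red curve, *planar* if $G^*(T)$ is a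 connected plane cubic graph, and *uncolorable* if $G^*(T)$ is uncolorable. A planar uncolorable trail is *minimal* if $G^*(T)$ is a smallest uncolorable graph, i.e. it has no isthmus and it has the least number of vertices among all uncolorable connected plane cubic graphs without isthmus. **Factorization.** Let a formation for $G(T)$ be given, and let the contextual colors be the colors at the two endpoints of the empty edge. If these are equal, the formation is *factored* if at least two of its curves pass through neither endpoint of the empty edge. If they are different, it is *factored* if at least one of its curves passes through neither endpoint. The trail $T$ is *prime* if no formation for $G(T)$ is factored. **Theorem.** The following two statements are equivalent. 1. (Primality Principle) Every minimal planar non-empty uncolorable trail is prime. 2. (Four Color Theorem, cubic graph form) Every connected plane cubic graph without isthmus is properly edge-colorable with three colors. -/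

import Mathlib

/-- A finite cubic multigraph (loops and multiple edges allowed) drawn on a closed oriented surface,
given as a combinatorial map.  A *dart* is an edge with a choice of one of its two ends.
`edge` exchanges the two darts of each edge; `rot` sends a dart to the next dart, counterclockwise,
around its vertex.  Edges are the orbits of `edge`, vertices are the orbits of `rot`
(each consisting of exactly three darts), faces are the orbits of `rot * edge`. -/
structure CubicMap where
  Dart : Type
  [fintypeDart : Fintype Dart]
  edge : Equiv.Perm Dart
  rot : Equiv.Perm Dart
  edge_edge : ∀ d, edge (edge d) = d
  edge_ne : ∀ d, edge d ≠ d
  rot_rot_rot : ∀ d, rot (rot (rot d)) = d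
  rot_ne : ∀ d, rot d ≠ d

attribute [instance] CubicMap.fintypeDart

/-- The three labels for edges.  Purple is the formal product of red and blue. -/
inductive EdgeColor
  | red
  | blue
  | purple

/-- The number of orbits of a permutation. -/
noncomputable def numOrbits {D : Type} (f : Equiv.Perm D) : ℕ :=
  Nat.card (Quotient (Equiv.Perm.SameCycle.setoid f))

namespace CubicMap

variable (M : CubicMap)

/-- The number of vertices. -/
noncomputable def numVertices : ℕ := numOrbits M.rot

/-- The number of edges. -/
noncomputable def numEdges : ℕ := numOrbits M.edge

/-- The number of faces. -/
noncomputable def numFaces : ℕ := numOrbits (M.rot * M.edge)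

/-- Two darts sit at the same vertex. -/
def SameVertex (d d' : M.Dart) : Prop := M.rot.SameCycle d d'

/-- The graph is connected (and not empty). -/
def IsConnected : Prop :=
  Nonempty M.Dart ∧
    ∀ d d' : M.Dart,
      Relation.ReflTransGen (fun x y => M.SameVertex x y ∨ y = M.edge x) d d'

/-- A connected plane cubic graph: a connected combinatorial map of genus `0`,
that is, one satisfying Euler's formula `V - E + F = 2`. -/
def IsConnectedPlane : Prop :=
  M.IsConnected ∧ M.numVertices + M.numFaces = M.numEdges + 2

/-- `d` is one of the two darts of the edge of the dart `a`. -/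
def IsOnEdge (a d : M.Dart) : Prop := d = a ∨ d = M.edge a

/-- The edge of the dart `a` is an isthmus: after its deletion (the vertices are kept)
some two vertices are not joined by a path. -/
def IsIsthmus (a : M.Dart) : Prop :=
  ¬ ∀ d d' : M.Dart,
      Relation.ReflTransGen
        (fun x y => M.SameVertex x y ∨ (y = M.edge x ∧ ¬ M.IsOnEdge a x)) d d'

/-- No edge is an isthmus. -/
def WithoutIsthmus : Prop := ∀ a : M.Dart, ¬ M.IsIsthmus a

/-- The graph is (properly) colorable: its edges can be labelled red, blue and purple such that
three distinct labels occur at every vertex. -/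
def IsColorable : Prop :=
  ∃ color : M.Dart → EdgeColor,
    (∀ d, color (M.edge d) = color d) ∧
      ∀ d d', M.SameVertex d d' → d ≠ d' → color d ≠ color d'

/-- A smallest (fewest vertices) uncolorable graph among the connected plane cubic graphs
without isthmus. -/
def IsSmallestPlaneUncolorable : Prop :=
  (M.IsConnectedPlane ∧ M.WithoutIsthmus ∧ ¬ M.IsColorable) ∧
    ∀ N : CubicMap, N.IsConnectedPlane → N.WithoutIsthmus → ¬ N.IsColorable →
      M.numVertices ≤ N.numVertices

/-- `d` sits at one of the two end vertices of the edge of the dart `a`. -/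
def IsAtEnd (a d : M.Dart) : Prop := M.SameVertex a d ∨ M.SameVertex (M.edge a) d

end CubicMap

/-- The Four Color Theorem in its cubic graph form. -/
def FourColorTheorem : Prop :=
  ∀ M : CubicMap, M.IsConnectedPlane → M.WithoutIsthmus → M.IsColorable

/-- A formation for the cubic graph obtained from `M` by deleting the edge of the dart `a`
(the *empty edge*) and forgetting its two end vertices, which become interior points of edges.
Formations are given by the corresponding colorings: `color` labels the remaining edges,
with three distinct labels at each remaining vertex, and with the same label on both sides
of an endpoint of the empty edge.  The values of `color` on the two darts of the empty edge are
irrelevant and never used. -/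
structure Formation (M : CubicMap) (a : M.Dart) where
  color : M.Dart → EdgeColor
  color_edge : ∀ d, ¬ M.IsOnEdge a d → color (M.edge d) = color d
  color_vertex : ∀ d d', ¬ M.IsAtEnd a d → M.SameVertex d d' → d ≠ d' → color d ≠ color d'
  color_end : ∀ d d', ¬ M.IsOnEdge a d → ¬ M.IsOnEdge a d' → M.IsAtEnd a d →
    M.SameVertex d d' → color d = color d'

/-- The three kinds of curves (two-color circuits) in a formation. -/
inductive CurveKind
  | red
  | blue
  | alternating

/-- Red curves run along red and purple edges, blue curves along blue and purple edges,
alternating curves along red and blue edges. -/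
def CurveKind.Uses : CurveKind → EdgeColor → Prop
  | .red, c => c = .red ∨ c = .purple
  | .blue, c => c = .blue ∨ c = .purple
  | .alternating, c => c = .red ∨ c = .blue

namespace Formation

variable {M : CubicMap} {a : M.Dart} (F : Formation M a)

/-- `d` is a dart of an edge on which curves of kind `k` run. -/
def Carries (k : CurveKind) (d : M.Dart) : Prop :=
  ¬ M.IsOnEdge a d ∧ k.Uses (F.color d)

/-- `d'` follows or precedes `d` immediately on a curve of kind `k`. -/
def Step (k : CurveKind) (d d' : M.Dart) : Prop :=
  F.Carries k d ∧ F.Carries k d' ∧ (d' = M.edge d ∨ M.SameVertex d d')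

/-- The curve of kind `k` through `d`, as a set of darts. -/
def curveThrough (k : CurveKind) (d : M.Dart) : Set M.Dart :=
  {d' | Relation.ReflTransGen (F.Step k) d d'}

/-- All the red, blue and alternating curves of the formation. -/
def curves : Set (CurveKind × Set M.Dart) :=
  {C | ∃ d, F.Carries C.1 d ∧ C.2 = F.curveThrough C.1 d}

/-- The curves of the formation that pass through neither endpoint of the empty edge. -/
def freeCurves : Set (CurveKind × Set M.Dart) :=
  {C | C ∈ F.curves ∧ ∀ d ∈ C.2, ¬ M.IsAtEnd a d}

/-- The two contextual curves have the same color: the color at the one endpoint of the empty edge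
is the color at the other one. -/
def SameContextColor : Prop := F.color (M.rot a) = F.color (M.rot (M.edge a))

/-- A formation is factored if,
* in the case of contextual curves of the same color, more than one curve of the formation
  remains besides those through the endpoints of the empty edge;
* in the case of contextual curves of different colors, some curve of the formation passes
  through neither endpoint of the empty edge. -/
def IsFactored : Prop :=
  (F.SameContextColor ∧ F.freeCurves.Nontrivial) ∨
    (¬ F.SameContextColor ∧ F.freeCurves.Nonempty)

end Formation

/-- A trail between two blue curves, drawn together with its empty edge: a formation, and an empty
edge that leads from one blue curve to another blue curve (the contextual curves).
All the other curves of the formation constitute the trail structure.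
Here `graph` is the cubic graph `G*(T)`, which includes the empty edge; the graph `G(T)` is `graph`
with the edge of `arrow` deleted and the two ends of `arrow` smoothed. -/
structure Trail where
  graph : CubicMap
  arrow : graph.Dart
  ends_ne : ¬ graph.SameVertex arrow (graph.edge arrow)
  formation : Formation graph arrow
  blue_tail : formation.color (graph.rot arrow) = .blue
  blue_head : formation.color (graph.rot (graph.edge arrow)) = .blue
  contextual_ne : formation.curveThrough .blue (graph.rot arrow) ≠
    formation.curveThrough .blue (graph.rot (graph.edge arrow))

namespace Trail

variable (T : Trail)

/-- The trail is planar: `G*(T)` (the formation together with the empty edge) is drawn in the plane,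
as a connected plane graph. -/
def IsPlanar : Prop := T.graph.IsConnectedPlane

/-- The trail is non-empty: the formation contains a red curve. -/
def IsNonempty : Prop := ∃ d, T.formation.Carries .red d

/-- The trail is uncolorable: `G*(T)` is an uncolorable graph. -/
def IsUncolorable : Prop := ¬ T.graph.IsColorable

/-- Minimality of a planar uncolorable trail: `G*(T)` is a smallest uncolorable graph (among the
connected plane cubic graphs without isthmus). -/
def IsMinimal : Prop := T.graph.IsSmallestPlaneUncolorable

/-- The trail factorizes: some formation for the graph `G(T)` is factored. -/
def Factorizes : Prop := ∃ F : Formation T.graph T.arrow, F.IsFactored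

/-- The trail is prime: it does not admit any factorization. -/
def IsPrime : Prop := ¬ T.Factorizes

end Trail

/-- The Primality Principle: a minimal planar non-empty uncolorable trail is prime. -/
def PrimalityPrinciple : Prop :=
  ∀ T : Trail, T.IsPlanar → T.IsNonempty → T.IsUncolorable → T.IsMinimal → T.IsPrime

/-! Given the Four Color Theorem, the Primality Principle is vacuous: the graph of a minimal planar
uncolorable trail would be a counterexample. Conversely, if the Four Color Theorem fails, there is a
smallest uncolorable plane graph `M` without isthmus, and `IsSmallestPlaneUncolorable.exists_trail`
builds on it a non-empty trail that is not prime.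

Some edge `a` of `M` lies in no two-edge cut (`exists_isRemovable`). Deleting it and smoothing its
ends gives a smaller graph of the same kind, which is colorable by minimality. With colors read as
the nonzero elements of the Klein four-group, the coloring becomes a flow on `M` that vanishes
exactly on `a`. Planarity, in the form that every cycle modulo 2 bounds (`isConnectedPlane_iff`),
turns the flow into a face coloring `c` with color 0 on both sides of `a` (`IsPotential`). The
curves of the three kinds are the boundary curves of the three regions formed by the faces colored 0
or `m`, with `m` nonzero. No curve passes both ends of `a`: otherwise, adding `m` along a path on it
between the ends, and giving `a` the color `m`, would color `M` (`isColorable_of_reflTransGen`). So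
a Kempe change (`IsPotential.exists_shift`) can alter the color at one end alone, and both ends can
be made blue.

The crux is parity. A Kempe change keeps the set of faces colored 0, and this set determines the
parity of the number of curves missing both ends (`even_ncard_freeCurves_add`). Indeed, the curves
are counted, up to a constant, by the orbits of walks in the three regions, and the sign of a
permutation gives the parity of its number of orbits. In the product of the three signs, the face
permutations contribute a quantity independent of `c`, and the edge exchanges combine into the
exchange of the edges bordering a face colored 0.

If the trail were prime, the formation with two blue ends would have at most one such free curve,
hence exactly one, because every red curve is free and there is one. A Kempe change on the blue
curve at one end makes the contextual colors purple and blue, and primality then allows no free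
curve. But 1 + 0 is odd. -/

/-! ### Invariant functions: orbit counts, connectivity, isthmuses. -/

lemma Equiv.Perm.SameCycle.apply_eq_of_invariant {D β : Type*} {f : Equiv.Perm D} {g : D → β}
    (h : ∀ d, g (f d) = g d) {x y : D} (hxy : f.SameCycle x y) : g x = g y := by
  obtain ⟨i, rfl⟩ := hxy
  induction i using Int.induction_on with
  | zero => simp
  | succ n ih => rw [add_comm, zpow_add, Equiv.Perm.mul_apply, zpow_one, h, ih]
  | pred n ih =>
    rw [ih, ← h ((f ^ (-(n : ℤ) - 1)) x), ← Equiv.Perm.mul_apply, ← zpow_one_add]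
    congr 3
    ring

/-- Functions that are constant along the cycles of a permutation. -/
def cycleInvariants {D : Type} (f : Equiv.Perm D) : Submodule (ZMod 2) (D → ZMod 2) where
  carrier := {x | ∀ d, x (f d) = x d}
  add_mem' hx hy d := by simp [hx d, hy d]
  zero_mem' _ := rfl
  smul_mem' a x hx d := by simp [hx d]

lemma mem_cycleInvariants {D : Type} {f : Equiv.Perm D} {x : D → ZMod 2} :
    x ∈ cycleInvariants f ↔ ∀ d, x (f d) = x d := Iff.rfl

/-- Invariant functions are functions on the set of cycles. -/
def cycleInvariantsEquiv {D : Type} (f : Equiv.Perm D) :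
    cycleInvariants f ≃ₗ[ZMod 2] (Quotient (Equiv.Perm.SameCycle.setoid f) → ZMod 2) where
  toFun x := Quotient.lift x.1 fun _ _ h => Equiv.Perm.SameCycle.apply_eq_of_invariant x.2 h
  invFun y := ⟨fun d => y (Quotient.mk _ d), fun d => by
    exact congrArg y (Quotient.sound (s := Equiv.Perm.SameCycle.setoid f)
      (Equiv.Perm.sameCycle_apply_left.2 (Equiv.Perm.SameCycle.refl f d)))⟩
  map_add' x y := by
    funext q
    induction q using Quotient.inductionOn with | h d => rfl
  map_smul' a x := by
    funext q
    induction q using Quotient.inductionOn with | h d => rfl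
  left_inv x := rfl
  right_inv y := by
    funext q
    induction q using Quotient.inductionOn with | h d => rfl

lemma finrank_cycleInvariants {D : Type} [Fintype D] (f : Equiv.Perm D) :
    Module.finrank (ZMod 2) (cycleInvariants f) = numOrbits f := by
  classical
  have := Fintype.ofFinite (Quotient (Equiv.Perm.SameCycle.setoid f))
  rw [LinearEquiv.finrank_eq (cycleInvariantsEquiv f), Module.finrank_fintype_fun_eq_card,
    numOrbits, Nat.card_eq_fintype_card]

namespace CubicMap

variable (M : CubicMap)

lemma rot_pow_three : M.rot ^ 3 = 1 := by
  ext d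
  simp [pow_succ, M.rot_rot_rot]

variable {M}

lemma sameVertex_iff {d d' : M.Dart} :
    M.SameVertex d d' ↔ d' = d ∨ d' = M.rot d ∨ d' = M.rot (M.rot d) := by
  constructor
  · rintro ⟨i, rfl⟩
    have h : M.rot ^ i = M.rot ^ (i % 3) := by
      conv_lhs => rw [← Int.emod_add_mul_ediv i 3, zpow_add, zpow_mul]
      rw [show M.rot ^ (3 : ℤ) = 1 from by exact_mod_cast M.rot_pow_three]
      simp
    rw [h]
    have h0 := Int.emod_nonneg i (show (3 : ℤ) ≠ 0 by norm_num)
    have h3 := Int.emod_lt_of_pos i (show (0 : ℤ) < 3 by norm_num)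
    generalize i % 3 = j at *
    interval_cases j
    · simp
    · simp
    · right; right
      rw [show (2 : ℤ) = ((2 : ℕ) : ℤ) from rfl, zpow_natCast, pow_two]
      rfl
  · rintro (rfl | rfl | rfl)
    · exact Equiv.Perm.SameCycle.refl _ _
    · exact ⟨1, by simp⟩
    · exact ⟨2, by rw [show (2 : ℤ) = ((2 : ℕ) : ℤ) from rfl, zpow_natCast, pow_two]; rfl⟩

lemma SameVertex.refl (d : M.Dart) : M.SameVertex d d := Equiv.Perm.SameCycle.refl _ _

lemma SameVertex.symm {d d' : M.Dart} (h : M.SameVertex d d') : M.SameVertex d' d :=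
  Equiv.Perm.SameCycle.symm h

lemma SameVertex.trans {d d' d'' : M.Dart} (h : M.SameVertex d d') (h' : M.SameVertex d' d'') :
    M.SameVertex d d'' := Equiv.Perm.SameCycle.trans h h'

lemma sameVertex_rot (d : M.Dart) : M.SameVertex d (M.rot d) := sameVertex_iff.2 (by simp)

lemma rot_rot_ne (d : M.Dart) : M.rot (M.rot d) ≠ d := fun h =>
  M.rot_ne d (by rw [← h, M.rot_rot_rot]; exact h.symm ▸ rfl)

/-- A function that is constant on vertices and on the edges satisfying `P` is constant along
paths through such edges. -/
lemma eq_of_reflTransGen {β : Type*} {P : M.Dart → Prop} {f : M.Dart → β}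
    (hr : ∀ d, f (M.rot d) = f d) (he : ∀ d, P d → f (M.edge d) = f d) {d d' : M.Dart}
    (h : Relation.ReflTransGen (fun x y => M.SameVertex x y ∨ (y = M.edge x ∧ P x)) d d') :
    f d = f d' := by
  induction h with
  | refl => rfl
  | tail _ h ih =>
    rcases h with h | ⟨rfl, h⟩
    · exact ih.trans (Equiv.Perm.SameCycle.apply_eq_of_invariant hr h)
    · exact ih.trans (he _ h).symm

/-- Reachability from `d` is itself such an invariant predicate; closure of `P` under `edge` is what
makes it invariant in both directions. Connectivity and isthmuses are handled in this dual form
because functions are easy to transport between a graph and its reduction. -/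
lemma forall_reflTransGen_iff {P : M.Dart → Prop} (hP : ∀ d, P d → P (M.edge d)) :
    (∀ d d', Relation.ReflTransGen
      (fun x y => M.SameVertex x y ∨ (y = M.edge x ∧ P x)) d d') ↔
    ∀ f : M.Dart → Prop, (∀ d, f (M.rot d) = f d) → (∀ d, P d → f (M.edge d) = f d) →
      ∀ d d', f d = f d' := by
  refine ⟨fun h f hr he d d' => eq_of_reflTransGen hr he (h d d'), fun h d d' => ?_⟩
  have key := h (fun x => Relation.ReflTransGen
      (fun x y => M.SameVertex x y ∨ (y = M.edge x ∧ P x)) d x)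
    (fun x => propext ⟨fun hx => hx.tail (Or.inl (sameVertex_rot x).symm),
      fun hx => hx.tail (Or.inl (sameVertex_rot x))⟩)
    (fun x hPx => propext ⟨fun hx => hx.tail (Or.inr ⟨(M.edge_edge x).symm, hP x hPx⟩),
      fun hx => hx.tail (Or.inr ⟨rfl, hPx⟩)⟩) d d'
  exact key.mp .refl

lemma isConnected_iff : M.IsConnected ↔ Nonempty M.Dart ∧
    ∀ f : M.Dart → Prop, (∀ d, f (M.rot d) = f d) → (∀ d, f (M.edge d) = f d) →
      ∀ d d', f d = f d' := by
  have := forall_reflTransGen_iff (M := M) (P := fun _ => True) (fun _ _ => trivial)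
  simpa [IsConnected] using fun _ => this

lemma IsConnected.eq {β : Type*} (hM : M.IsConnected) {f : M.Dart → β}
    (hr : ∀ d, f (M.rot d) = f d) (he : ∀ d, f (M.edge d) = f d) (d d' : M.Dart) : f d = f d' := by
  refine eq_of_reflTransGen (P := fun _ => True) hr (fun d _ => he d) ?_
  simpa using hM.2 d d'

lemma isOnEdge_edge {a d : M.Dart} : M.IsOnEdge a (M.edge d) ↔ M.IsOnEdge a d := by
  unfold IsOnEdge
  constructor
  · rintro (h | h)
    · exact Or.inr (by rw [← h, M.edge_edge])
    · exact Or.inl (M.edge.injective h)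
  · rintro (rfl | rfl)
    · exact Or.inr rfl
    · exact Or.inl (M.edge_edge _)

lemma not_isIsthmus_iff {a : M.Dart} : ¬ M.IsIsthmus a ↔
    ∀ f : M.Dart → Prop, (∀ d, f (M.rot d) = f d) →
      (∀ d, ¬ M.IsOnEdge a d → f (M.edge d) = f d) → ∀ d d', f d = f d' := by
  rw [IsIsthmus, not_not]
  exact forall_reflTransGen_iff fun d hd => by rwa [isOnEdge_edge]

end CubicMap

/-! ### Planarity as exactness of cycles modulo 2. -/

lemma mem_orthogonal_dotProductBilin {D : Type} [Fintype D]
    {S : Submodule (ZMod 2) (D → ZMod 2)} {z : D → ZMod 2} :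
    z ∈ LinearMap.BilinForm.orthogonal (dotProductBilin (ZMod 2) (ZMod 2)) S ↔
      ∀ w ∈ S, w ⬝ᵥ z = 0 := Iff.rfl

/-- Indicators of the pairs `{d, f d}` test for invariance; conversely the terms at `d` and `f d` of
a product of two invariant functions cancel. -/
lemma mem_orthogonal_cycleInvariants_involution {D : Type} [Fintype D] {f : Equiv.Perm D}
    (hf : ∀ d, f (f d) = d) (hne : ∀ d, f d ≠ d) {z : D → ZMod 2} :
    z ∈ LinearMap.BilinForm.orthogonal (dotProductBilin (ZMod 2) (ZMod 2)) (cycleInvariants f) ↔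
      z ∈ cycleInvariants f := by
  classical
  have h2 : ∀ x : ZMod 2, x + x = 0 := by decide
  have h2' : ∀ x y : ZMod 2, x + y = 0 → y = x := by decide
  rw [mem_orthogonal_dotProductBilin]
  constructor
  · intro h d
    have hw : (Pi.single d 1 + Pi.single (f d) 1 : D → ZMod 2) ∈ cycleInvariants f := by
      intro e
      have h1 : f e = d ↔ e = f d := ⟨fun h => by rw [← h, hf], fun h => by rw [h, hf]⟩
      simp [Pi.single_apply, h1, add_comm]
    have := h _ hw
    simp only [add_dotProduct, single_one_dotProduct] at this
    exact h2' _ _ this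
  · intro hz w hw
    rw [dotProduct]
    refine Finset.sum_involution (fun d _ => f d) (fun d _ => ?_) (fun d _ _ => hne d)
      (fun d _ => Finset.mem_univ _) (fun d _ => hf d)
    rw [hz d, hw d, h2]

/-- The sums of the indicators of `d`, `f d` and `f (f d)` test the condition. Conversely, three
reindexings of the same scalar product add up to 0, and 3 is invertible modulo 2. -/
lemma mem_orthogonal_cycleInvariants_three {D : Type} [Fintype D] {f : Equiv.Perm D}
    (hf : ∀ d, f (f (f d)) = d) {z : D → ZMod 2} :
    z ∈ LinearMap.BilinForm.orthogonal (dotProductBilin (ZMod 2) (ZMod 2)) (cycleInvariants f) ↔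
      ∀ d, z d + z (f d) + z (f (f d)) = 0 := by
  classical
  rw [mem_orthogonal_dotProductBilin]
  constructor
  · intro h d
    have hw : (Pi.single d 1 + Pi.single (f d) 1 + Pi.single (f (f d)) 1 : D → ZMod 2) ∈
        cycleInvariants f := by
      intro e
      have h1 : f e = d ↔ e = f (f d) := ⟨fun h => by rw [← h, hf], fun h => by rw [h, hf]⟩
      simp only [Pi.add_apply, Pi.single_apply, h1, f.injective.eq_iff]
      ring
    have := h _ hw
    simpa only [add_dotProduct, single_one_dotProduct] using this
  · intro hz w hw
    rw [dotProduct]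
    have h1 : ∑ d, w d * z (f d) = ∑ d, w d * z d := by
      rw [← Equiv.sum_comp f (fun d => w d * z d)]
      simp [hw _]
    have h2 : ∑ d, w d * z (f (f d)) = ∑ d, w d * z d := by
      rw [← Equiv.sum_comp f (fun d => w d * z d), ← Equiv.sum_comp f (fun d => w (f d) * z (f d))]
      simp [hw _]
    have h3 : ∑ d, w d * (z d + z (f d) + z (f (f d))) = 0 := by simp [hz]
    simp only [mul_add, Finset.sum_add_distrib, h1, h2] at h3
    have : ∀ x : ZMod 2, x + x + x = 0 → x = 0 := by decide
    exact this _ h3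

namespace CubicMap

/-- Every cycle modulo `2` of the graph is the boundary of a set of faces. -/
def CyclesBound (M : CubicMap) : Prop :=
  ∀ z : M.Dart → ZMod 2, (∀ d, z (M.edge d) = z d) →
    (∀ d, z d + z (M.rot d) + z (M.rot (M.rot d)) = 0) →
    ∃ c : M.Dart → ZMod 2, (∀ d, c (M.rot d) = c (M.edge d)) ∧ ∀ d, c (M.edge d) = c d + z d

variable {M : CubicMap}

lemma mem_cycleInvariants_face {c : M.Dart → ZMod 2} :
    c ∈ cycleInvariants (M.rot * M.edge) ↔ ∀ d, c (M.rot d) = c (M.edge d) := by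
  rw [mem_cycleInvariants]
  constructor
  · intro h d
    have := h (M.edge d)
    rwa [Equiv.Perm.mul_apply, M.edge_edge] at this
  · intro h d
    rw [Equiv.Perm.mul_apply, h, M.edge_edge]

lemma IsConnected.finrank_eq_one (hM : M.IsConnected) {S : Submodule (ZMod 2) (M.Dart → ZMod 2)}
    (h1 : (fun _ => 1) ∈ S) (hS : ∀ x ∈ S, (∀ d, x (M.rot d) = x d) ∧ ∀ d, x (M.edge d) = x d) :
    Module.finrank (ZMod 2) S = 1 := by
  have : S = Submodule.span (ZMod 2) {fun _ => 1} := by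
    refine le_antisymm (fun x hx => ?_) (by simpa using h1)
    obtain ⟨d0⟩ := hM.1
    rw [Submodule.mem_span_singleton]
    refine ⟨x d0, ?_⟩
    funext d
    simpa using hM.eq (hS x hx).1 (hS x hx).2 d0 d
  rw [this]
  refine finrank_span_singleton fun h => ?_
  obtain ⟨d0⟩ := hM.1
  simpa using congrFun h d0

/-- A connected map is plane if and only if every cycle modulo `2` bounds. -/
lemma IsConnected.isConnectedPlane_iff (hM : M.IsConnected) :
    M.IsConnectedPlane ↔ M.CyclesBound := by
  classical
  set Q : LinearMap.BilinForm (ZMod 2) (M.Dart → ZMod 2) :=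
    dotProductBilin (ZMod 2) (ZMod 2) with hQ
  have hQr : Q.IsRefl := by
    intro x y h
    exact (dotProduct_comm y x).trans h
  have hQt : Q.orthogonal ⊤ = ⊥ := by
    rw [eq_bot_iff]
    intro x hx
    rw [Submodule.mem_bot]
    funext d
    exact (single_one_dotProduct d x).symm.trans (hx (Pi.single d 1) trivial)
  set C0 := cycleInvariants M.rot with hC0
  set C1 := cycleInvariants M.edge with hC1
  set C2 := cycleInvariants (M.rot * M.edge) with hC2
  have horth : ∀ S : Submodule (ZMod 2) (M.Dart → ZMod 2),
      Module.finrank (ZMod 2) S + Module.finrank (ZMod 2) (Q.orthogonal S) =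
        Fintype.card M.Dart := by
    intro S
    rw [LinearMap.BilinForm.finrank_add_finrank_orthogonal hQr, hQt]
    simp
  have h11 : Q.orthogonal C1 = C1 := by
    ext z
    exact mem_orthogonal_cycleInvariants_involution M.edge_edge M.edge_ne
  have hE : 2 * M.numEdges = Fintype.card M.Dart := by
    have := horth C1
    rw [h11, finrank_cycleInvariants] at this
    rw [← this, numEdges, two_mul]
  -- Connectedness reduces the intersection to the constants, so the sum has dimension E + V - 1.
  have hsup : Module.finrank (ZMod 2) (C1 ⊔ C0 : Submodule _ _) + 1 =
      M.numEdges + M.numVertices := by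
    have := Submodule.finrank_sup_add_finrank_inf_eq C1 C0
    rw [finrank_cycleInvariants, finrank_cycleInvariants, hM.finrank_eq_one (S := C1 ⊓ C0)
      ⟨fun _ => rfl, fun _ => rfl⟩ (fun x hx => ⟨hx.2, hx.1⟩)] at this
    exact this
  -- `Z` is the cycle space, of dimension 2E - (E + V - 1) = E - V + 1.
  set Z := Q.orthogonal (C1 ⊔ C0) with hZ
  have hZmem : ∀ z, z ∈ Z ↔ (∀ d, z (M.edge d) = z d) ∧
      ∀ d, z d + z (M.rot d) + z (M.rot (M.rot d)) = 0 := by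
    intro z
    have h0 := mem_orthogonal_cycleInvariants_three M.rot_rot_rot (z := z)
    have h1 := mem_orthogonal_cycleInvariants_involution M.edge_edge M.edge_ne (z := z)
    rw [mem_cycleInvariants] at h1
    rw [← h0, ← h1]
    constructor
    · intro h
      exact ⟨LinearMap.BilinForm.orthogonal_le le_sup_left h,
        LinearMap.BilinForm.orthogonal_le le_sup_right h⟩
    · rintro ⟨h, h'⟩ w hw
      obtain ⟨x, hx, y, hy, rfl⟩ := Submodule.mem_sup.1 hw
      have hx' : x ⬝ᵥ z = 0 := h x hx
      have hy' : y ⬝ᵥ z = 0 := h' y hy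
      exact (add_dotProduct x y z).trans (by rw [hx', hy', add_zero])
  have hZdim : Module.finrank (ZMod 2) (C1 ⊔ C0 : Submodule _ _) + Module.finrank (ZMod 2) Z =
      Fintype.card M.Dart := horth _
  -- `L` adds the values on the two sides of an edge. On face functions its kernel is the constants,
  -- so the space `B` of boundaries has dimension F - 1.
  set L : (M.Dart → ZMod 2) →ₗ[ZMod 2] (M.Dart → ZMod 2) :=
    LinearMap.funLeft (ZMod 2) (ZMod 2) M.edge + LinearMap.id with hL
  have hLapp : ∀ c d, L c d = c (M.edge d) + c d := fun _ _ => rfl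
  have hadd : ∀ x y : ZMod 2, x + y = 0 → x = y := by decide
  set B := C2.map L with hB
  have hBdim : Module.finrank (ZMod 2) B + 1 = M.numFaces := by
    have := LinearMap.finrank_range_add_finrank_ker (L.domRestrict C2)
    rw [finrank_cycleInvariants, LinearMap.range_domRestrict] at this
    rw [numFaces, ← this]
    congr 1
    rw [LinearMap.ker_domRestrict, ← Submodule.finrank_map_subtype_eq, Submodule.map_comap_subtype]
    symm
    refine hM.finrank_eq_one ⟨fun _ => rfl, ?_⟩ ?_
    · refine LinearMap.mem_ker.2 ?_
      funext d
      rw [hLapp]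
      exact (by decide : (1 : ZMod 2) + 1 = 0)
    · rintro x ⟨hx, hx'⟩
      have he : ∀ d, x (M.edge d) = x d := fun d =>
        hadd _ _ ((hLapp x d).symm.trans (congrFun (LinearMap.mem_ker.1 hx') d))
      refine ⟨fun d => ?_, he⟩
      rw [mem_cycleInvariants_face.1 hx, he]
  have hBZ : B ≤ Z := by
    rintro _ ⟨c, hc, rfl⟩
    have hc' := mem_cycleInvariants_face.1 hc
    rw [hZmem]
    refine ⟨fun d => by rw [hLapp, hLapp, M.edge_edge, add_comm], fun d => ?_⟩
    rw [hLapp, hLapp, hLapp, ← hc', ← hc', ← hc', M.rot_rot_rot]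
    generalize c d = x
    generalize c (M.rot d) = y
    generalize c (M.rot (M.rot d)) = z
    revert x y z
    decide
  have hiff : M.CyclesBound ↔ B = Z := by
    have hflip : ∀ x y z : ZMod 2, x + y = z ↔ x = y + z := by decide
    constructor
    · intro h
      refine le_antisymm hBZ fun z hz => ?_
      obtain ⟨c, hc, hcz⟩ := h z ((hZmem z).1 hz).1 ((hZmem z).1 hz).2
      refine ⟨c, mem_cycleInvariants_face.2 hc, ?_⟩
      funext d
      rw [hLapp, hflip, hcz]
    · intro h z hz hz'
      have : z ∈ B := h ▸ (hZmem z).2 ⟨hz, hz'⟩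
      obtain ⟨c, hc, rfl⟩ := this
      refine ⟨c, mem_cycleInvariants_face.1 hc, fun d => ?_⟩
      rw [← hflip, hLapp]
  -- Since `B ≤ Z`, equality means F - 1 = E - V + 1, which is Euler's formula.
  rw [hiff, IsConnectedPlane]
  constructor
  · rintro ⟨-, h⟩
    exact Submodule.eq_of_le_of_finrank_eq hBZ (by omega)
  · intro h
    refine ⟨hM, ?_⟩
    rw [h] at hBdim
    omega

end CubicMap

/-! ### Two-edge cuts and the existence of a removable edge. -/

namespace CubicMap

variable {M : CubicMap}

/-- The number of edges leaving a set of vertices. -/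
noncomputable def cutSize (X : M.Dart → Prop) : ℕ := {d | X d ∧ ¬ X (M.edge d)}.ncard

/-- The edge of `a` can be removed without creating an isthmus: no other edge forms
a two-edge cut with it. -/
def IsRemovable (a : M.Dart) : Prop :=
  ∀ g, ¬ M.IsOnEdge a g → ∀ f : M.Dart → Prop, (∀ d, f (M.rot d) = f d) →
    (∀ d, ¬ M.IsOnEdge a d → ¬ M.IsOnEdge g d → f (M.edge d) = f d) → ∀ d d', f d = f d'

lemma cutSize_not (X : M.Dart → Prop) : cutSize (fun d => ¬ X d) = cutSize X := by
  refine Set.ncard_congr (fun d _ => M.edge d) ?_ ?_ ?_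
  · rintro d ⟨h, h'⟩
    exact ⟨not_not.1 h', by rwa [M.edge_edge]⟩
  · intro d d' _ _ h
    exact M.edge.injective h
  · rintro d ⟨h, h'⟩
    exact ⟨M.edge d, ⟨h', by rwa [M.edge_edge, not_not]⟩, M.edge_edge d⟩

/-- Submodularity of the cut function, used to uncross two two-edge cuts. -/
lemma cutSize_and_add_cutSize_or_le (X Y : M.Dart → Prop) :
    cutSize (fun d => X d ∧ Y d) + cutSize (fun d => X d ∨ Y d) ≤ cutSize X + cutSize Y := by
  unfold cutSize
  rw [← Set.ncard_union_add_ncard_inter, ← Set.ncard_union_add_ncard_inter {d | X d ∧ _}]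
  refine Nat.add_le_add (Set.ncard_le_ncard ?_ (Set.toFinite _))
    (Set.ncard_le_ncard ?_ (Set.toFinite _))
  · intro d
    simp only [Set.mem_union, Set.mem_ofPred_eq]
    tauto
  · intro d
    simp only [Set.mem_inter_iff, Set.mem_ofPred_eq]
    tauto

lemma two_le_cutSize (hM : M.IsConnected) (hi : M.WithoutIsthmus) {X : M.Dart → Prop}
    (hX : ∀ d, X (M.rot d) = X d) (h1 : ∃ d, X d) (h0 : ∃ d, ¬ X d) : 2 ≤ cutSize X := by
  obtain ⟨d1, h1⟩ := h1
  obtain ⟨d0, h0⟩ := h0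
  have hne : X d1 ≠ X d0 := fun h => h0 (h ▸ h1)
  by_contra! hlt
  have hle : cutSize X ≤ 1 := by omega
  rw [cutSize, Set.ncard_le_one (Set.toFinite _)] at hle
  by_cases hg : ∃ g, X g ∧ ¬ X (M.edge g)
  · obtain ⟨g, hg⟩ := hg
    refine hne (not_isIsthmus_iff.1 (hi g) X hX (fun d hd => ?_) d1 d0)
    by_contra h
    refine hd ?_
    by_cases hXd : X d
    · exact Or.inl (hle d ⟨hXd, fun h' => h (propext ⟨fun _ => hXd, fun _ => h'⟩)⟩ g hg)
    · refine Or.inr ?_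
      rw [← hle (M.edge d) ⟨by_contra fun h' => h (propext ⟨fun h'' => (h' h'').elim,
        fun h'' => (hXd h'').elim⟩), by rwa [M.edge_edge]⟩ g hg, M.edge_edge]
  · push Not at hg
    refine hne (hM.eq hX (fun d => propext ⟨fun h => ?_, hg d⟩) d1 d0)
    simpa [M.edge_edge] using hg _ h

/-- Each of the two edges has at most one dart leaving the set `f`, and a cut of size less than 2
would need an isthmus or a disconnected graph. -/
lemma cutSize_eq_two (hM : M.IsConnected) (hi : M.WithoutIsthmus) {a g : M.Dart}
    {f : M.Dart → Prop} (hf : ∀ d, f (M.rot d) = f d)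
    (he : ∀ d, ¬ M.IsOnEdge a d → ¬ M.IsOnEdge g d → f (M.edge d) = f d)
    (h1 : ∃ d, f d) (h0 : ∃ d, ¬ f d) : cutSize f = 2 := by
  classical
  refine le_antisymm ?_ (two_le_cutSize hM hi hf h1 h0)
  refine (Set.ncard_le_ncard (t := {if f a then a else M.edge a, if f g then g else M.edge g})
    ?_ (Set.toFinite _)).trans ((Set.ncard_insert_le _ _).trans (by simp))
  rintro d ⟨hd, hd'⟩
  have : M.IsOnEdge a d ∨ M.IsOnEdge g d := by
    by_contra! h
    exact hd' (he d h.1 h.2 ▸ hd)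
  rcases this with (rfl | rfl) | (rfl | rfl)
  · exact Or.inl (by simp [hd])
  · rw [M.edge_edge] at hd'
    exact Or.inl (by simp [hd'])
  · exact Or.inr (by simp [hd])
  · rw [M.edge_edge] at hd'
    exact Or.inr (by simp [hd'])

/-- Otherwise all three darts at a single vertex of `X` would leave it. -/
lemma exists_inner_edge {X : M.Dart → Prop} (hX : ∀ d, X (M.rot d) = X d) (h1 : ∃ d, X d)
    (h2 : cutSize X = 2) : ∃ e, X e ∧ X (M.edge e) := by
  by_contra! h
  obtain ⟨d, hd⟩ := h1
  have hd1 : X (M.rot d) := by rwa [hX]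
  have hd2 : X (M.rot (M.rot d)) := by rwa [hX]
  have hsub : ({d, M.rot d, M.rot (M.rot d)} : Set M.Dart) ⊆ {d | X d ∧ ¬ X (M.edge d)} := by
    rintro e (rfl | rfl | rfl)
    · exact ⟨hd, h _ hd⟩
    · exact ⟨hd1, h _ hd1⟩
    · exact ⟨hd2, h _ hd2⟩
  have hle := Set.ncard_le_ncard hsub (Set.toFinite _)
  have h3 : ({d, M.rot d, M.rot (M.rot d)} : Set M.Dart).ncard = 3 :=
    Set.ncard_eq_three.2 ⟨_, _, _, (M.rot_ne d).symm, (rot_rot_ne d).symm, (M.rot_ne _).symm, rfl⟩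
  rw [cutSize] at h2
  omega

/-- A connected cubic graph without isthmus has a removable edge. -/
theorem exists_isRemovable (hM : M.IsConnected) (hi : M.WithoutIsthmus) :
    ∃ a : M.Dart, IsRemovable a := by
  classical
  have nontriv : ∀ {f : M.Dart → Prop} {d d' : M.Dart}, f d ≠ f d' → (∃ d, f d) ∧ ∃ d, ¬ f d := by
    intro f d d' h
    by_cases h1 : f d <;> by_cases h2 : f d'
    · exact (h (propext (by tauto))).elim
    · exact ⟨⟨d, h1⟩, ⟨d', h2⟩⟩
    · exact ⟨⟨d', h2⟩, ⟨d, h1⟩⟩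
    · exact (h (propext (by tauto))).elim
  set P : (M.Dart → Prop) → Prop := fun X =>
    (∀ d, X (M.rot d) = X d) ∧ (∃ d, X d) ∧ (∃ d, ¬ X d) ∧ cutSize X = 2 with hP
  by_cases hne : ∃ X, P X
  -- A smallest side `X` of a two-edge cut; any edge inside it turns out to be removable.
  · obtain ⟨X, ⟨hX, hX1, hX0, hX2⟩, hmin⟩ :=
      exists_minimalFor_of_wellFoundedLT P (fun X => {d | X d}.ncard) hne
    obtain ⟨e, he, he'⟩ := exists_inner_edge hX hX1 hX2
    -- Uncrossing: the cuts of `X ∩ Y` and `X ∪ Y` have size at least 2 and total at most 4, so `X ∩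
    -- Y` is a smaller side of a two-edge cut.
    have key : ∀ Y : M.Dart → Prop, (∀ d, Y (M.rot d) = Y d) → cutSize Y = 2 →
        (∃ d, X d ∧ Y d) → (∃ d, X d ∧ ¬ Y d) → (∃ d, ¬ X d ∧ ¬ Y d) → False := by
      rintro Y hY hY2 ⟨d1, h1⟩ ⟨d2, h2⟩ ⟨d3, h3⟩
      have hA := two_le_cutSize hM hi (X := fun d => X d ∧ Y d) (fun d => by rw [hX, hY]) ⟨d1, h1⟩
        ⟨d2, fun h => h2.2 h.2⟩
      have hO := two_le_cutSize hM hi (X := fun d => X d ∨ Y d) (fun d => by rw [hX, hY])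
        ⟨d1, Or.inl h1.1⟩ ⟨d3, fun h => h.elim h3.1 h3.2⟩
      have := cutSize_and_add_cutSize_or_le X Y
      have hsub : {d | X d ∧ Y d} ⊂ {d | X d} :=
        ⟨fun d hd => hd.1, fun h => h2.2 (h h2.1).2⟩
      have hlt := Set.ncard_lt_ncard hsub (Set.toFinite _)
      have hle := hmin (j := fun d => X d ∧ Y d) ⟨fun d => by simp only [hX, hY], ⟨d1, h1⟩,
        ⟨d2, fun h => h2.2 h.2⟩, by omega⟩ hlt.le
      exact absurd hle (not_le.2 hlt)
    refine ⟨e, fun g hg f hf hfe => ?_⟩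
    by_contra! hd
    obtain ⟨d, d', hd⟩ := hd
    obtain ⟨h1, h0⟩ := nontriv hd
    have h2 := cutSize_eq_two hM hi hf hfe h1 h0
    -- If `f` did not separate the ends of `e`, the edge of `g` alone would be an isthmus.
    have hfne : f (M.edge e) ≠ f e := by
      intro h
      refine hd (not_isIsthmus_iff.1 (hi g) f hf (fun x hx => ?_) d d')
      by_cases hex : M.IsOnEdge e x
      · rcases hex with rfl | rfl
        · exact h
        · rw [M.edge_edge, h]
      · exact hfe x hex hx
    have hXf : (∃ d, X d ∧ f d) ∧ ∃ d, X d ∧ ¬ f d := by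
      by_cases hfe : f e
      · exact ⟨⟨e, he, hfe⟩, ⟨M.edge e, he', fun h => hfne (propext (by tauto))⟩⟩
      · exact ⟨⟨M.edge e, he', by_contra fun h => hfne (propext (by tauto))⟩, ⟨e, he, hfe⟩⟩
    obtain ⟨x, hx⟩ := hX0
    -- Choose between the two sides of the second cut so that `x` is outside both sets.
    by_cases hfx : f x
    · exact key (fun d => ¬ f d) (fun d => by rw [hf]) (by rw [cutSize_not, h2]) hXf.2
        (by simpa using hXf.1) ⟨x, hx, by simpa using hfx⟩
    · exact key f hf h2 hXf.1 hXf.2 ⟨x, hx, hfx⟩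
  · obtain ⟨a⟩ := hM.1
    refine ⟨a, fun g _ f hf hfe => ?_⟩
    by_contra! hd
    obtain ⟨d, d', hd⟩ := hd
    obtain ⟨h1, h0⟩ := nontriv hd
    exact hne ⟨f, hf, h1, h0, cutSize_eq_two hM hi hf hfe h1 h0⟩

/-- A cubic graph without isthmus has no loops. -/
lemma WithoutIsthmus.not_sameVertex_edge (hi : M.WithoutIsthmus) (d : M.Dart) :
    ¬ M.SameVertex d (M.edge d) := by
  have key : ∀ d, M.edge d ≠ M.rot d := by
    intro d hd
    have hd' : M.edge (M.rot d) = d := by rw [← hd, M.edge_edge]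
    have h3 := M.rot_rot_rot d
    -- A loop uses two darts of its vertex, so the edge at the third dart separates this vertex from
    -- the rest.
    have := not_isIsthmus_iff.1 (hi (M.rot (M.rot d)))
      (fun x => x = d ∨ x = M.rot d ∨ x = M.rot (M.rot d)) ?_ ?_ d (M.edge (M.rot (M.rot d)))
    · simp only [true_or, eq_iff_iff, true_iff] at this
      rcases this with h | h | h
      · have := congrArg M.edge h
        rw [M.edge_edge, hd] at this
        exact M.rot_ne _ this
      · have := congrArg M.edge h
        rw [M.edge_edge, hd'] at this
        exact rot_rot_ne _ this
      · exact M.edge_ne _ h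
    · intro x
      have h1 : M.rot x = d ↔ x = M.rot (M.rot d) := by
        rw [← M.rot.injective.eq_iff (b := M.rot (M.rot d)), h3]
      simp only [h1, M.rot.injective.eq_iff, eq_iff_iff]
      tauto
    · intro x hx
      have hxt : x ≠ M.rot (M.rot d) := fun h => hx (Or.inl h)
      have hxt' : M.edge x ≠ M.rot (M.rot d) := fun h => hx (Or.inr (by rw [← h, M.edge_edge]))
      have h1 : M.edge x = d ↔ x = M.rot d := by
        rw [← M.edge.injective.eq_iff (b := M.rot d), hd']
      have h2 : M.edge x = M.rot d ↔ x = d := by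
        rw [← M.edge.injective.eq_iff (b := d), hd]
      simp only [h1, h2, hxt, hxt', or_false, eq_iff_iff]
      tauto
  rw [sameVertex_iff]
  rintro (h | h | h)
  · exact M.edge_ne d h
  · exact key d h
  · refine key (M.edge d) ?_
    rw [M.edge_edge, h, M.rot_rot_rot]

end CubicMap

/-! ### Deleting an edge and smoothing its ends. -/

namespace CubicMap

variable {M : CubicMap} {a : M.Dart}

lemma IsAtEnd.of_sameVertex {d d' : M.Dart} (h : M.IsAtEnd a d) (hd : M.SameVertex d d') :
    M.IsAtEnd a d' := h.imp (fun h => h.trans hd) (fun h => h.trans hd)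

lemma isAtEnd_rot {d : M.Dart} : M.IsAtEnd a (M.rot d) ↔ M.IsAtEnd a d :=
  ⟨fun h => h.of_sameVertex (sameVertex_rot d).symm, fun h => h.of_sameVertex (sameVertex_rot d)⟩

lemma IsOnEdge.isAtEnd {d : M.Dart} (h : M.IsOnEdge a d) : M.IsAtEnd a d := by
  rcases h with rfl | rfl
  · exact Or.inl (.refl _)
  · exact Or.inr (.refl _)

open Classical in
/-- At an end of the edge of `a`, the other dart that does not belong to this edge. -/
noncomputable def across (a d : M.Dart) : M.Dart :=
  if M.IsOnEdge a (M.rot d) then M.rot (M.rot d) else M.rot d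

lemma sameVertex_across (d : M.Dart) : M.SameVertex d (across a d) := by
  rw [sameVertex_iff]
  unfold across
  split_ifs <;> simp

lemma IsAtEnd.isAtEnd_across {d : M.Dart} (h : M.IsAtEnd a d) : M.IsAtEnd a (across a d) :=
  h.of_sameVertex (sameVertex_across d)

lemma across_ne (d : M.Dart) : across a d ≠ d := by
  unfold CubicMap.across
  split_ifs
  · exact rot_rot_ne d
  · exact M.rot_ne d

lemma IsAtEnd.sameVertex_of_not {d d' d'' : M.Dart} (h : M.IsAtEnd a d) (h' : M.IsAtEnd a d')
    (h'' : M.IsAtEnd a d'') (hd : ¬ M.SameVertex d d') (hd' : ¬ M.SameVertex d' d'') :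
    M.SameVertex d d'' := by
  rcases h with h | h <;> rcases h' with h' | h' <;> rcases h'' with h'' | h''
  · exact (hd (h.symm.trans h')).elim
  · exact (hd (h.symm.trans h')).elim
  · exact h.symm.trans h''
  · exact (hd' (h'.symm.trans h'')).elim
  · exact (hd' (h'.symm.trans h'')).elim
  · exact h.symm.trans h''
  · exact (hd (h.symm.trans h')).elim
  · exact (hd (h.symm.trans h')).elim

/-- The three darts at an end of the edge of `a`. -/
lemma IsAtEnd.cases (ha : ¬ M.SameVertex a (M.edge a))
    {d : M.Dart} (h : M.IsAtEnd a d) (hd : ¬ M.IsOnEdge a d) :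
    ∃ b, M.IsOnEdge a b ∧ ¬ M.IsOnEdge a (M.rot b) ∧ ¬ M.IsOnEdge a (M.rot (M.rot b)) ∧
      (d = M.rot b ∧ across a d = M.rot (M.rot b) ∨
        d = M.rot (M.rot b) ∧ across a d = M.rot b) := by
  have key : ∀ b, M.IsOnEdge a b → ¬ M.SameVertex b (M.edge b) := by
    rintro b (rfl | rfl)
    · exact ha
    · rw [M.edge_edge]
      exact fun h => ha h.symm
  have key2 : ∀ b, M.IsOnEdge a b → M.SameVertex b d → ∃ b, M.IsOnEdge a b ∧
      ¬ M.IsOnEdge a (M.rot b) ∧ ¬ M.IsOnEdge a (M.rot (M.rot b)) ∧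
      (d = M.rot b ∧ across a d = M.rot (M.rot b) ∨
        d = M.rot (M.rot b) ∧ across a d = M.rot b) := by
    intro b hb hbd
    have hon : ∀ x, M.IsOnEdge a x → x = b ∨ x = M.edge b := by
      rintro x (rfl | rfl) <;> rcases hb with rfl | rfl <;> simp [M.edge_edge]
    have hb1 : ¬ M.IsOnEdge a (M.rot b) := by
      intro h
      rcases hon _ h with h | h
      · exact M.rot_ne _ h
      · exact key b hb (h ▸ sameVertex_rot b)
    have hb2 : ¬ M.IsOnEdge a (M.rot (M.rot b)) := by
      intro h
      rcases hon _ h with h | h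
      · exact rot_rot_ne _ h
      · exact key b hb (h ▸ sameVertex_iff.2 (by simp))
    refine ⟨b, hb, hb1, hb2, ?_⟩
    rcases sameVertex_iff.1 hbd with rfl | rfl | rfl
    · exact (hd hb).elim
    · exact Or.inl ⟨rfl, by rw [CubicMap.across, if_neg hb2]⟩
    · refine Or.inr ⟨rfl, ?_⟩
      rw [CubicMap.across, if_pos (by rwa [M.rot_rot_rot]), M.rot_rot_rot]
  rcases h with h | h
  · exact key2 _ (Or.inl rfl) h
  · exact key2 _ (Or.inr rfl) h

lemma IsAtEnd.not_isOnEdge_across (ha : ¬ M.SameVertex a (M.edge a))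
    {d : M.Dart} (h : M.IsAtEnd a d) (hd : ¬ M.IsOnEdge a d) :
    ¬ M.IsOnEdge a (across a d) := by
  obtain ⟨b, hb, hb1, hb2, ⟨-, h⟩ | ⟨-, h⟩⟩ := h.cases ha hd <;> rwa [h]

lemma IsAtEnd.eq_or_eq_across (ha : ¬ M.SameVertex a (M.edge a))
    {d d' : M.Dart} (h : M.IsAtEnd a d) (hd : ¬ M.IsOnEdge a d)
    (hd' : ¬ M.IsOnEdge a d') (hdd' : M.SameVertex d d') : d' = d ∨ d' = across a d := by
  have h3 := M.rot_rot_rot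
  obtain ⟨b, hb, hb1, hb2, ⟨h1, h2⟩ | ⟨h1, h2⟩⟩ := h.cases ha hd <;> rw [h2] <;>
    rcases sameVertex_iff.1 hdd' with h | h | h
  · exact Or.inl h
  · exact Or.inr (by rw [h, h1])
  · rw [h1, h3] at h
    exact (hd' (h ▸ hb)).elim
  · exact Or.inl h
  · rw [h1, h3] at h
    exact (hd' (h ▸ hb)).elim
  · exact Or.inr (by rw [h, h1, h3])

lemma IsAtEnd.across_across (ha : ¬ M.SameVertex a (M.edge a))
    {d : M.Dart} (h : M.IsAtEnd a d) (hd : ¬ M.IsOnEdge a d) :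
    across a (across a d) = d := by
  have := (h.isAtEnd_across).eq_or_eq_across ha (h.not_isOnEdge_across ha hd) hd
    (sameVertex_across d).symm
  exact (this.resolve_left (across_ne d).symm).symm

/-- A function on faces that agrees on both sides of the edge of `a` agrees on both sides of each
edge obtained by forgetting an end of this edge. -/
lemma IsAtEnd.apply_edge_across (ha : ¬ M.SameVertex a (M.edge a))
    {β : Type*} {c : M.Dart → β} (hc : ∀ d, c (M.rot d) = c (M.edge d))
    (hca : c (M.edge a) = c a) {d : M.Dart} (h : M.IsAtEnd a d) (hd : ¬ M.IsOnEdge a d) :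
    c (M.edge (across a d)) = c d := by
  have hb' : ∀ b, M.IsOnEdge a b → c (M.edge b) = c b := by
    rintro b (rfl | rfl)
    · exact hca
    · rw [M.edge_edge, hca]
  obtain ⟨b, hb, -, -, ⟨h1, h2⟩ | ⟨h1, h2⟩⟩ := h.cases ha hd <;> rw [h2, h1, ← hc]
  · rw [M.rot_rot_rot, hc, hb' b hb]

lemma not_isOnEdge_of_not_isAtEnd {d : M.Dart} (h : ¬ M.IsAtEnd a d) : ¬ M.IsOnEdge a d :=
  fun h' => h h'.isAtEnd

/-- If two successive edges are bypassed, the third one is not. -/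
lemma not_isAtEnd_bypass (ha : ¬ M.SameVertex a (M.edge a))
    (hl : ∀ d, ¬ M.SameVertex d (M.edge d)) {d : M.Dart} (h : ¬ M.IsAtEnd a d)
    (h1 : M.IsAtEnd a (M.edge d))
    (h2 : M.IsAtEnd a (M.edge (across a (M.edge d)))) :
    ¬ M.IsAtEnd a (M.edge (across a (M.edge (across a (M.edge d))))) := by
  intro h3
  have hn := not_isOnEdge_of_not_isAtEnd h
  have hn1 : ¬ M.IsOnEdge a (M.edge d) := by rwa [isOnEdge_edge]
  have hn2 : ¬ M.IsOnEdge a (M.edge (across a (M.edge d))) := by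
    rw [isOnEdge_edge]; exact h1.not_isOnEdge_across ha hn1
  have hn3 : ¬ M.IsOnEdge a (M.edge (across a (M.edge (across a (M.edge d))))) := by
    rw [isOnEdge_edge]; exact h2.not_isOnEdge_across ha hn2
  -- Without loops the two ends alternate, so the third dart is back at the first end. Only two
  -- darts there are off `a`: one would put `d` at an end, the other would be a fixed point of
  -- `across`.
  have hs := IsAtEnd.sameVertex_of_not h1.isAtEnd_across h2.isAtEnd_across h3
    (fun h' => hl _ (h'.trans (sameVertex_across _).symm)) (hl _)
  rcases h1.eq_or_eq_across ha hn1 hn3 ((sameVertex_across _).trans hs) with h' | h'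
  · exact h (M.edge.injective h' ▸ h2.isAtEnd_across)
  · have := congrArg M.edge h'
    rw [M.edge_edge] at this
    exact across_ne _ this

end CubicMap

namespace CubicMap

variable {M : CubicMap} {a : M.Dart}

open Classical in
/-- The other dart of the edge of `d`, after the edge of `a` has been deleted and
its ends have been forgotten. -/
noncomputable def bypass (a d : M.Dart) : M.Dart :=
  if M.IsAtEnd a (M.edge d) then
    if M.IsAtEnd a (M.edge (across a (M.edge d))) then
      M.edge (across a (M.edge (across a (M.edge d))))
    else M.edge (across a (M.edge d))
  else M.edge d

lemma bypass_of_not {d : M.Dart} (h : ¬ M.IsAtEnd a (M.edge d)) : bypass a d = M.edge d := by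
  rw [bypass, if_neg h]

lemma bypass_of_not' {d : M.Dart} (h : M.IsAtEnd a (M.edge d))
    (h' : ¬ M.IsAtEnd a (M.edge (across a (M.edge d)))) :
    bypass a d = M.edge (across a (M.edge d)) := by
  rw [bypass, if_pos h, if_neg h']

lemma bypass_of {d : M.Dart} (h : M.IsAtEnd a (M.edge d))
    (h' : M.IsAtEnd a (M.edge (across a (M.edge d)))) :
    bypass a d = M.edge (across a (M.edge (across a (M.edge d)))) := by
  rw [bypass, if_pos h, if_pos h']

lemma not_isAtEnd_bypass_apply (ha : ¬ M.SameVertex a (M.edge a))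
    (hl : ∀ d, ¬ M.SameVertex d (M.edge d)) {d : M.Dart} (h : ¬ M.IsAtEnd a d) :
    ¬ M.IsAtEnd a (bypass a d) := by
  unfold bypass
  split_ifs with h1 h2
  · exact not_isAtEnd_bypass ha hl h h1 h2
  · exact h2
  · exact h1

lemma bypass_bypass (ha : ¬ M.SameVertex a (M.edge a)) {d : M.Dart} (h : ¬ M.IsAtEnd a d) :
    bypass a (bypass a d) = d := by
  have hn : ¬ M.IsOnEdge a (M.edge d) := by
    rw [isOnEdge_edge]
    exact not_isOnEdge_of_not_isAtEnd h
  by_cases h1 : M.IsAtEnd a (M.edge d)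
  · have hx := h1.across_across ha hn
    by_cases h2 : M.IsAtEnd a (M.edge (across a (M.edge d)))
    · have hn2 : ¬ M.IsOnEdge a (M.edge (across a (M.edge d))) := by
        rw [isOnEdge_edge]
        exact h1.not_isOnEdge_across ha hn
      have hy := h2.across_across ha hn2
      rw [bypass_of h1 h2, bypass_of] <;> rw [M.edge_edge]
      · rw [hy, M.edge_edge, hx, M.edge_edge]
      · exact h2.isAtEnd_across
      · rw [hy, M.edge_edge]
        exact h1.isAtEnd_across
    · rw [bypass_of_not' h1 h2, bypass_of_not'] <;> rw [M.edge_edge]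
      · rw [hx, M.edge_edge]
      · exact h1.isAtEnd_across
      · rwa [hx, M.edge_edge]
  · rw [bypass_of_not h1, bypass_of_not, M.edge_edge]
    rwa [M.edge_edge]

lemma bypass_ne (hl : ∀ d, ¬ M.SameVertex d (M.edge d)) (d : M.Dart) : bypass a d ≠ d := by
  unfold bypass
  split_ifs with h1 h2
  · intro h
    have := congrArg M.edge h
    rw [M.edge_edge] at this
    refine hl (across a (M.edge d)) ((sameVertex_across _).symm.trans ?_)
    have hv := (sameVertex_across (a := a) (M.edge (across a (M.edge d)))).symm
    rwa [this] at hv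
  · intro h
    have := congrArg M.edge h
    rw [M.edge_edge] at this
    exact across_ne _ this
  · exact M.edge_ne d

/-- `N` is the graph obtained from `M` by deleting the edge of `a` and forgetting its two ends;
`v` is the inclusion of its darts. -/
structure IsDeletion (a : M.Dart) (N : CubicMap) (v : N.Dart → M.Dart) : Prop where
  injective : Function.Injective v
  not_isAtEnd : ∀ d, ¬ M.IsAtEnd a (v d)
  exists_eq : ∀ d, ¬ M.IsAtEnd a d → ∃ e, v e = d
  rot : ∀ d, v (N.rot d) = M.rot (v d)
  edge : ∀ d, v (N.edge d) = bypass a (v d)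

lemma exists_isDeletion (ha : ¬ M.SameVertex a (M.edge a))
    (hl : ∀ d, ¬ M.SameVertex d (M.edge d)) :
    ∃ (N : CubicMap) (v : N.Dart → M.Dart), IsDeletion a N v := by
  classical
  exact ⟨{
    Dart := {d : M.Dart // ¬ M.IsAtEnd a d}
    fintypeDart := Subtype.fintype _
    edge := Function.Involutive.toPerm
      (fun d => ⟨bypass a d, not_isAtEnd_bypass_apply ha hl d.2⟩)
      (fun d => Subtype.ext (bypass_bypass ha d.2))
    rot := M.rot.subtypePerm fun d => not_congr isAtEnd_rot
    edge_edge := fun d => Subtype.ext (bypass_bypass ha d.2)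
    edge_ne := fun d h => bypass_ne hl d.1 (congrArg Subtype.val h)
    rot_rot_rot := fun d => Subtype.ext (M.rot_rot_rot d)
    rot_ne := fun d h => M.rot_ne d (congrArg Subtype.val h) },
    Subtype.val, Subtype.val_injective, fun d => d.2, fun d h => ⟨⟨d, h⟩, rfl⟩,
    fun _ => rfl, fun _ => rfl⟩

/-- A function on the edges of the graph without `a` gives a function on the edges of
the graph with `a`. -/
lemma exists_extension {X : Type*} [Nonempty X] (ha : ¬ M.SameVertex a (M.edge a))
    (hl : ∀ d, ¬ M.SameVertex d (M.edge d)) (z : M.Dart → X)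
    (hz : ∀ d, ¬ M.IsAtEnd a d → z (bypass a d) = z d) :
    ∃ y : M.Dart → X, (∀ d, ¬ M.IsAtEnd a d → y d = z d) ∧
      (∀ d, ¬ M.IsOnEdge a d → y (M.edge d) = y d) ∧
      ∀ d, M.IsAtEnd a d → ¬ M.IsOnEdge a d → y (across a d) = y d := by
  classical
  obtain ⟨x0⟩ := ‹Nonempty X›
  -- At an end, take the value at the first surviving dart met through `edge d`. Two passages
  -- through ends occur beside an edge parallel to `a`. Off `a`, the default `x0` is reached only on
  -- a circle without vertices.
  set y : M.Dart → X := fun d =>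
    if ¬ M.IsAtEnd a d then z d
    else if ¬ M.IsAtEnd a (M.edge d) then z (M.edge d)
    else if ¬ M.IsAtEnd a (M.edge (across a (M.edge d))) then z (M.edge (across a (M.edge d)))
    else x0 with hy
  have y0 : ∀ d, ¬ M.IsAtEnd a d → y d = z d := fun d h => if_pos h
  have y1 : ∀ d, M.IsAtEnd a d → ¬ M.IsAtEnd a (M.edge d) → y d = z (M.edge d) := fun d h h' => by
    simp only [hy]
    rw [if_neg (not_not.2 h), if_pos h']
  have y2 : ∀ d, M.IsAtEnd a d → M.IsAtEnd a (M.edge d) →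
      ¬ M.IsAtEnd a (M.edge (across a (M.edge d))) → y d = z (M.edge (across a (M.edge d))) :=
    fun d h h' h'' => by
      simp only [hy]
      rw [if_neg (not_not.2 h), if_neg (not_not.2 h'), if_pos h'']
  have y3 : ∀ d, M.IsAtEnd a d → M.IsAtEnd a (M.edge d) →
      M.IsAtEnd a (M.edge (across a (M.edge d))) → y d = x0 :=
    fun d h h' h'' => by
      simp only [hy]
      rw [if_neg (not_not.2 h), if_neg (not_not.2 h'), if_neg (not_not.2 h'')]
  have hin : ∀ d, M.IsAtEnd a d → ¬ M.IsOnEdge a d → M.IsAtEnd a (M.edge d) →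
      ¬ M.IsAtEnd a (M.edge (across a d)) → ¬ M.IsAtEnd a (M.edge (across a (M.edge d))) ∧
        z (M.edge (across a d)) = z (M.edge (across a (M.edge d))) := by
    intro d h hn h1 h2
    have hd := h.across_across ha hn
    have e1 : M.IsAtEnd a (M.edge (M.edge (across a d))) := by
      rw [M.edge_edge]; exact h.isAtEnd_across
    have e2 : M.IsAtEnd a (M.edge (across a (M.edge (M.edge (across a d))))) := by
      rwa [M.edge_edge, hd]
    have h3 := not_isAtEnd_bypass ha hl h2 e1 e2
    have h4 := hz _ h2
    rw [bypass_of e1 e2] at h4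
    rw [M.edge_edge, hd] at h3 h4
    exact ⟨h3, h4.symm⟩
  refine ⟨y, y0, fun d hn => ?_, fun d h hn => ?_⟩
  · by_cases h : M.IsAtEnd a d
    · by_cases h1 : M.IsAtEnd a (M.edge d)
      · have hn1 : ¬ M.IsOnEdge a (M.edge d) := by rwa [isOnEdge_edge]
        by_cases h2 : M.IsAtEnd a (M.edge (across a d))
        · have h3 : M.IsAtEnd a (M.edge (across a (M.edge d))) := by
            by_contra h3
            have := (hin (M.edge d) h1 hn1 (by rwa [M.edge_edge]) h3).1
            rw [M.edge_edge] at this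
            exact this h2
          rw [y3 d h h1 h3, y3 _ h1 (by rwa [M.edge_edge]) (by rwa [M.edge_edge])]
        · obtain ⟨h3, h4⟩ := hin d h hn h1 h2
          rw [y2 d h h1 h3, y2 _ h1 (by rwa [M.edge_edge]) (by rwa [M.edge_edge]), M.edge_edge, h4]
      · rw [y0 _ h1, y1 _ h h1]
    · rw [y0 _ h]
      by_cases h1 : M.IsAtEnd a (M.edge d)
      · rw [y1 _ h1 (by rwa [M.edge_edge]), M.edge_edge]
      · rw [y0 _ h1, ← hz d h, bypass_of_not h1]
  · have hd := h.across_across ha hn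
    have h' := h.isAtEnd_across
    have hn' := h.not_isOnEdge_across ha hn
    by_cases h1 : M.IsAtEnd a (M.edge d) <;> by_cases h2 : M.IsAtEnd a (M.edge (across a d))
    · have hv : M.SameVertex (M.edge d) (M.edge (across a d)) :=
        h1.sameVertex_of_not h h2 (fun h => hl _ h.symm)
          (fun h => hl _ ((sameVertex_across d).symm.trans h))
      have := h1.eq_or_eq_across ha (by rwa [isOnEdge_edge]) (by rwa [isOnEdge_edge]) hv
      rcases this with h3 | h3
      · exact (across_ne _ (M.edge.injective h3)).elim
      · have h4 := (h1.across_across ha (by rwa [isOnEdge_edge]))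
        rw [← h3] at h4
        rw [y3 d h h1 (by rwa [← h3, M.edge_edge]), y3 _ h' h2 (by rwa [h4, M.edge_edge])]
    · obtain ⟨h3, h4⟩ := hin d h hn h1 h2
      rw [y1 _ h' h2, y2 d h h1 h3, h4]
    · obtain ⟨h3, h4⟩ := hin _ h' hn' h2 (by rwa [hd])
      rw [y1 _ h h1, y2 _ h' h2 h3, ← h4, hd]
    · have h3 := hz _ h1
      rw [bypass_of_not', M.edge_edge] at h3
      · rw [y1 _ h h1, y1 _ h' h2, h3]
      · rwa [M.edge_edge]
      · rwa [M.edge_edge]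

lemma apply_bypass {β : Type*} {c : M.Dart → β} (ha : ¬ M.SameVertex a (M.edge a))
    (hc : ∀ d, c (M.rot d) = c (M.edge d)) (hca : c (M.edge a) = c a) {d : M.Dart}
    (h : ¬ M.IsAtEnd a d) : c (bypass a d) = c (M.edge d) := by
  have hn : ¬ M.IsOnEdge a (M.edge d) := by
    rw [isOnEdge_edge]
    exact not_isOnEdge_of_not_isAtEnd h
  by_cases h1 : M.IsAtEnd a (M.edge d)
  · have hx := h1.apply_edge_across ha hc hca hn
    by_cases h2 : M.IsAtEnd a (M.edge (across a (M.edge d)))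
    · rw [bypass_of h1 h2, h2.apply_edge_across ha hc hca, hx]
      rw [isOnEdge_edge]
      exact h1.not_isOnEdge_across ha hn
    · rw [bypass_of_not' h1 h2, hx]
  · rw [bypass_of_not h1]

end CubicMap

namespace CubicMap

variable {M : CubicMap} {a : M.Dart}

/-- A function on the vertices of the graph without `a` which is a function on edges except at
one dart extends to the graph with `a`. -/
lemma exists_vertex_extension (ha : ¬ M.SameVertex a (M.edge a))
    (hl : ∀ d, ¬ M.SameVertex d (M.edge d)) (z : M.Dart → Prop)
    (hz : ∀ d, ¬ M.IsAtEnd a d → z (bypass a d) = z d) :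
    ∃ y : M.Dart → Prop, (∀ d, ¬ M.IsAtEnd a d → y d = z d) ∧
      (∀ d, ¬ M.IsOnEdge a d → y (M.edge d) = y d) ∧
      ∀ d, M.IsAtEnd a d → y (M.rot d) = y d := by
  classical
  obtain ⟨x, hx0, hx1, hx2⟩ := exists_extension ha hl z hz
  -- The two darts of `a` copy the value of a neighbor at their own vertex; nothing is required
  -- across `a`.
  refine ⟨fun d => if M.IsOnEdge a d then x (M.rot d) else x d, fun d h => ?_, fun d h => ?_,
    fun d h => ?_⟩
  · simp only [if_neg (not_isOnEdge_of_not_isAtEnd h), hx0 d h]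
  · simp only [if_neg h, isOnEdge_edge, hx1 d h]
  · have h3 := M.rot_rot_rot
    have hx3 : ∀ b, M.IsOnEdge a b → M.IsAtEnd a b → ¬ M.IsOnEdge a (M.rot b) →
        ¬ M.IsOnEdge a (M.rot (M.rot b)) → x (M.rot (M.rot b)) = x (M.rot b) := by
      intro b hb he h1 h2
      rw [← hx2 (M.rot b) (isAtEnd_rot.2 he) h1]
      unfold across
      rw [if_neg h2]
    by_cases hd : M.IsOnEdge a d
    · have h1 : ¬ M.IsOnEdge a (M.rot d) := by
        intro h1
        rcases hd with rfl | rfl <;> rcases h1 with h1 | h1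
        · exact M.rot_ne _ h1
        · exact ha (h1 ▸ sameVertex_rot _)
        · exact ha (SameVertex.symm (by simpa [h1] using sameVertex_rot (M.edge a)))
        · exact M.rot_ne _ h1
      simp only [if_pos hd, if_neg h1]
    · obtain ⟨b, hb, h1, h2, ⟨rfl, -⟩ | ⟨rfl, -⟩⟩ := h.cases ha hd
      · simp only [if_neg h1, if_neg h2]
        exact hx3 b hb hb.isAtEnd h1 h2
      · simp only [h3, if_pos hb, if_neg h2]
        exact (hx3 b hb hb.isAtEnd h1 h2).symm

/-- The three darts at an end of the edge of `a`. -/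
lemma IsAtEnd.exists_eq (ha : ¬ M.SameVertex a (M.edge a)) {d : M.Dart} (h : M.IsAtEnd a d) :
    ∃ b, M.IsOnEdge a b ∧ ¬ M.IsOnEdge a (M.rot b) ∧ ¬ M.IsOnEdge a (M.rot (M.rot b)) ∧
      (d = b ∨ d = M.rot b ∨ d = M.rot (M.rot b)) := by
  by_cases hd : M.IsOnEdge a d
  · have h1 : ¬ M.IsOnEdge a (M.rot d) := by
      intro h1
      rcases hd with rfl | rfl <;> rcases h1 with h1 | h1
      · exact M.rot_ne _ h1
      · exact ha (h1 ▸ sameVertex_rot _)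
      · exact ha (SameVertex.symm (by simpa [h1] using sameVertex_rot (M.edge a)))
      · exact M.rot_ne _ h1
    obtain ⟨b, hb, hb1, hb2, ⟨h3, -⟩ | ⟨h3, -⟩⟩ := (isAtEnd_rot.2 h).cases ha h1
    · exact ⟨b, hb, hb1, hb2, Or.inl (M.rot.injective h3)⟩
    · exact ⟨b, hb, hb1, hb2, Or.inr (Or.inl (M.rot.injective h3))⟩
  · obtain ⟨b, hb, hb1, hb2, ⟨h3, -⟩ | ⟨h3, -⟩⟩ := h.cases ha hd
    · exact ⟨b, hb, hb1, hb2, Or.inr (Or.inl h3)⟩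
    · exact ⟨b, hb, hb1, hb2, Or.inr (Or.inr h3)⟩

namespace IsDeletion

variable {N : CubicMap} {v : N.Dart → M.Dart}

lemma sameVertex_iff (hD : IsDeletion a N v) {d d' : N.Dart} :
    N.SameVertex d d' ↔ M.SameVertex (v d) (v d') := by
  rw [CubicMap.sameVertex_iff, CubicMap.sameVertex_iff, ← hD.rot, ← hD.rot,
    hD.injective.eq_iff, hD.injective.eq_iff, hD.injective.eq_iff]

/-- Functions on the darts of the reduced graph, seen on the darts of the graph. -/
lemma exists_lift (hD : IsDeletion a N v) {X : Type*} [Nonempty X] (f : N.Dart → X) :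
    ∃ z : M.Dart → X, ∀ d, z (v d) = f d := by
  obtain ⟨x0⟩ := ‹Nonempty X›
  exact ⟨Function.extend v f fun _ => x0, fun d => hD.injective.extend_apply _ _ _⟩

lemma numVertices_lt (hD : IsDeletion a N v) : N.numVertices < M.numVertices := by
  classical
  have := Fintype.ofFinite (Quotient (Equiv.Perm.SameCycle.setoid M.rot))
  have := Fintype.ofFinite (Quotient (Equiv.Perm.SameCycle.setoid N.rot))
  have hs : ∀ d d' : M.Dart, (Quotient.mk (Equiv.Perm.SameCycle.setoid M.rot) d =
      Quotient.mk (Equiv.Perm.SameCycle.setoid M.rot) d') ↔ M.SameVertex d d' :=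
    fun d d' => Quotient.eq (r := Equiv.Perm.SameCycle.setoid M.rot)
  unfold numVertices numOrbits
  rw [Nat.card_eq_fintype_card, Nat.card_eq_fintype_card]
  refine Fintype.card_lt_of_injective_of_notMem
    (fun q => Quotient.lift (fun d => Quotient.mk (Equiv.Perm.SameCycle.setoid M.rot) (v d))
      (fun d d' h => (hs _ _).2 (hD.sameVertex_iff.1 h)) q) ?_
    (b := Quotient.mk _ a) ?_
  · intro q q' h
    induction q using Quotient.inductionOn with | h d => ?_
    induction q' using Quotient.inductionOn with | h d' => ?_
    exact Quotient.sound (hD.sameVertex_iff.2 ((hs _ _).1 h))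
  · rintro ⟨q, h⟩
    induction q using Quotient.inductionOn with | h d => ?_
    exact hD.not_isAtEnd d (Or.inl ((hs _ _).1 h).symm)

/-- Invariance under the edges of the reduced graph, seen on the darts of the graph. -/
lemma apply_bypass_of_lift (hD : IsDeletion a N v) {X : Type*} {f : N.Dart → X} {z : M.Dart → X}
    (hz : ∀ d, z (v d) = f d) (he : ∀ d, f (N.edge d) = f d) (d : M.Dart)
    (h : ¬ M.IsAtEnd a d) : z (bypass a d) = z d := by
  obtain ⟨e, rfl⟩ := hD.exists_eq d h
  rw [← hD.edge, hz, hz, he]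

lemma isConnected (hD : IsDeletion a N v) (ha : ¬ M.SameVertex a (M.edge a))
    (hl : ∀ d, ¬ M.SameVertex d (M.edge d)) (hi : ¬ M.IsIsthmus a)
    (hne : Nonempty N.Dart) : N.IsConnected := by
  refine isConnected_iff.2 ⟨hne, fun f hr he d d' => ?_⟩
  obtain ⟨z, hz⟩ := hD.exists_lift f
  obtain ⟨y, hy0, hy1, hy2⟩ := exists_vertex_extension ha hl z (hD.apply_bypass_of_lift hz he)
  have hyf : ∀ d, y (v d) = f d := fun d => by rw [hy0 _ (hD.not_isAtEnd d), hz]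
  have := not_isIsthmus_iff.1 hi y (fun d => ?_) hy1 (v d) (v d')
  · rwa [hyf, hyf] at this
  · by_cases h : M.IsAtEnd a d
    · exact hy2 d h
    · obtain ⟨e, rfl⟩ := hD.exists_eq d h
      rw [← hD.rot, hyf, hyf, hr]

/-- An isthmus of the reduced graph would form a two-edge cut of `M` together with `a`. -/
lemma withoutIsthmus (hD : IsDeletion a N v) (ha : ¬ M.SameVertex a (M.edge a))
    (hl : ∀ d, ¬ M.SameVertex d (M.edge d)) (hr : IsRemovable a) : N.WithoutIsthmus := by
  classical
  intro g
  refine not_isIsthmus_iff.2 fun f hfr hfe d d' => ?_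
  -- Overwriting `f` at the single dart `g` makes it invariant under all edges, so it extends to
  -- `M`. Restoring the value at `v g` afterwards confines the jump to the edge of `v g` in `M`.
  obtain ⟨z, hz⟩ := hD.exists_lift (Function.update f g (f (N.edge g)))
  have hinv : ∀ d, Function.update f g (f (N.edge g)) (N.edge d) =
      Function.update f g (f (N.edge g)) d := by
    intro d
    by_cases h1 : d = g
    · rw [h1, Function.update_self, Function.update_of_ne (N.edge_ne g)]
    · rw [Function.update_of_ne h1]
      by_cases h2 : N.edge d = g
      · rw [h2, Function.update_self, ← h2, N.edge_edge]
      · rw [Function.update_of_ne h2]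
        refine hfe _ ?_
        rintro (h3 | h3)
        · exact h1 h3
        · exact h2 (by rw [h3, N.edge_edge])
  obtain ⟨y, hy0, hy1, hy2⟩ := exists_vertex_extension ha hl z (hD.apply_bypass_of_lift hz hinv)
  have hn : ∀ x : N.Dart, Function.update y (v g) (f g) (v x) = f x := by
    intro x
    by_cases hx : x = g
    · rw [hx, Function.update_self]
    · rw [Function.update_of_ne (fun h => hx (hD.injective h)), hy0 _ (hD.not_isAtEnd x), hz,
        Function.update_of_ne hx]
  have key := hr (v g) (not_isOnEdge_of_not_isAtEnd (hD.not_isAtEnd g))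
    (Function.update y (v g) (f g)) ?_ ?_ (v d) (v d')
  · rwa [hn, hn] at key
  · intro x
    by_cases hx : M.IsAtEnd a x
    · have h1 : x ≠ v g := fun h => hD.not_isAtEnd g (h ▸ hx)
      have h2 : M.rot x ≠ v g := fun h => hD.not_isAtEnd g (h ▸ isAtEnd_rot.2 hx)
      rw [Function.update_of_ne h1, Function.update_of_ne h2, hy2 x hx]
    · obtain ⟨e, rfl⟩ := hD.exists_eq x hx
      rw [← hD.rot, hn, hn, hfr]
  · intro x hx hgx
    have h1 : x ≠ v g := fun h => hgx (Or.inl h)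
    have h2 : M.edge x ≠ v g := fun h => hgx (Or.inr (by rw [← h, M.edge_edge]))
    rw [Function.update_of_ne h1, Function.update_of_ne h2, hy1 x hx]

/-- A function on the edges of the reduced graph whose sum vanishes at each vertex
extends to the graph. -/
lemma exists_flow_extension (hD : IsDeletion a N v) (ha : ¬ M.SameVertex a (M.edge a))
    (hl : ∀ d, ¬ M.SameVertex d (M.edge d)) {X : Type*} [AddCommGroup X]
    (h2 : ∀ x : X, x + x = 0) {S : Set X} (hS : S.Nonempty) (f : N.Dart → X) (hfS : ∀ d, f d ∈ S)
    (he : ∀ d, f (N.edge d) = f d) (hf : ∀ d, f d + f (N.rot d) + f (N.rot (N.rot d)) = 0) :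
    ∃ y : M.Dart → X, (∀ d, y (v d) = f d) ∧ (∀ d, y (M.edge d) = y d) ∧
      (∀ d, M.IsOnEdge a d → y d = 0) ∧ (∀ d, ¬ M.IsOnEdge a d → y d ∈ S) ∧
      ∀ d, y d + y (M.rot d) + y (M.rot (M.rot d)) = 0 := by
  classical
  have := hS.to_subtype
  obtain ⟨z, hz⟩ := hD.exists_lift (X := S) (fun d => ⟨f d, hfS d⟩)
  obtain ⟨x, hx0, hx1, hx2⟩ := exists_extension ha hl z
    (hD.apply_bypass_of_lift hz fun d => Subtype.ext (he d))
  obtain ⟨y, hy⟩ : ∃ y : M.Dart → X, ∀ d, y d = if M.IsOnEdge a d then 0 else (x d : X) :=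
    ⟨_, fun _ => rfl⟩
  have hy0 : ∀ d, M.IsOnEdge a d → y d = 0 := fun d h => by rw [hy, if_pos h]
  have hy1 : ∀ d, ¬ M.IsOnEdge a d → y d = x d := fun d h => by rw [hy, if_neg h]
  have hyf : ∀ d, y (v d) = f d := fun d => by
    rw [hy1 _ (not_isOnEdge_of_not_isAtEnd (hD.not_isAtEnd d)), hx0 _ (hD.not_isAtEnd d), hz]
  refine ⟨y, hyf, fun d => ?_, hy0, fun d h => hy1 d h ▸ (x d).2, fun d => ?_⟩
  · by_cases h : M.IsOnEdge a d
    · rw [hy0 _ h, hy0 _ (isOnEdge_edge.2 h)]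
    · rw [hy1 _ h, hy1 _ (mt isOnEdge_edge.1 h), hx1 _ h]
  · by_cases h : M.IsAtEnd a d
    · obtain ⟨b, hb, hb1, hb2, h3⟩ := h.exists_eq ha
      have h4 : x (M.rot (M.rot b)) = x (M.rot b) := by
        rw [← hx2 (M.rot b) (isAtEnd_rot.2 hb.isAtEnd) hb1, across, if_neg hb2]
      have h5 : y b + y (M.rot b) + y (M.rot (M.rot b)) = 0 := by
        rw [hy0 _ hb, hy1 _ hb1, hy1 _ hb2, h4, zero_add, h2]
      rcases h3 with rfl | rfl | rfl
      · exact h5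
      · rw [M.rot_rot_rot, ← h5]
        abel
      · rw [M.rot_rot_rot, ← h5]
        abel
    · obtain ⟨e, rfl⟩ := hD.exists_eq d h
      rw [← hD.rot, ← hD.rot, hyf, hyf, hyf, hf]

/-- A cycle of the reduced graph extends to a cycle of `M` that vanishes on `a`. A face function
bounding it agrees on both sides of `a`, hence is a face function of the reduced graph. Planarity
thus passes on without a count of faces. -/
lemma cyclesBound (hD : IsDeletion a N v) (ha : ¬ M.SameVertex a (M.edge a))
    (hl : ∀ d, ¬ M.SameVertex d (M.edge d)) (hM : M.CyclesBound) : N.CyclesBound := by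
  intro f he hf
  obtain ⟨y, hyf, hye, hya, -, hyv⟩ := hD.exists_flow_extension ha hl (S := Set.univ) (by decide)
    ⟨0, trivial⟩ f (fun _ => trivial) he hf
  obtain ⟨c, hc, hcy⟩ := hM y hye hyv
  have hca : c (M.edge a) = c a := by rw [hcy, hya a (Or.inl rfl), add_zero]
  have key : ∀ d, c (v (N.edge d)) = c (v d) + f d := by
    intro d
    rw [hD.edge, apply_bypass ha hc hca (hD.not_isAtEnd d), hcy, hyf]
  refine ⟨fun d => c (v d), fun d => ?_, key⟩
  simp only [key, hD.rot]
  rw [hc, hcy, hyf]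

/-- Deleting a removable edge gives a smaller graph of the same kind. -/
theorem isConnectedPlane (hD : IsDeletion a N v) (ha : ¬ M.SameVertex a (M.edge a))
    (hl : ∀ d, ¬ M.SameVertex d (M.edge d)) (hM : M.IsConnectedPlane) (hi : ¬ M.IsIsthmus a)
    (hne : Nonempty N.Dart) : N.IsConnectedPlane :=
  ((hD.isConnected ha hl hi hne).isConnectedPlane_iff).2
    (hD.cyclesBound ha hl (hM.1.isConnectedPlane_iff.1 hM))

end IsDeletion

end CubicMap

/-! ### Colorings as flows with values in the Klein four-group. -/

/-- The Klein four-group. -/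
abbrev Klein : Type := ZMod 2 × ZMod 2

/-- The labels as the nonzero elements of the Klein four-group; purple is the sum of red
and blue. -/
def EdgeColor.toKlein : EdgeColor → Klein
  | .red => (1, 0)
  | .blue => (0, 1)
  | .purple => (1, 1)

namespace Klein

/-- The label given by a nonzero element of the Klein four-group. -/
def toColor (x : Klein) : EdgeColor :=
  if x = (1, 0) then .red else if x = (0, 1) then .blue else .purple

lemma toKlein_toColor : ∀ {x : Klein}, x ≠ 0 → (toColor x).toKlein = x := by
  have : ∀ x : Klein, x ≠ 0 → (toColor x).toKlein = x := by decide
  exact fun {x} => this x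

lemma toColor_injective {x y : Klein} (hx : x ≠ 0) (hy : y ≠ 0) (h : toColor x = toColor y) :
    x = y := by
  rw [← toKlein_toColor hx, ← toKlein_toColor hy, h]

lemma add_self (x : Klein) : x + x = 0 := by
  revert x
  decide

lemma ne_of_add_eq_zero {x y z : Klein} (h : x + y + z = 0) (hz : z ≠ 0) : x ≠ y := by
  rintro rfl
  rw [add_self, zero_add] at h
  exact hz h

lemma add_eq_zero_of_ne {x y z : Klein} (hx : x ≠ 0) (hy : y ≠ 0) (hz : z ≠ 0) (hxy : x ≠ y)
    (hyz : y ≠ z) (hxz : x ≠ z) : x + y + z = 0 := by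
  revert x y z
  decide

lemma eq_add_of_add_eq {x y z : Klein} (h : x + y = z) : y = x + z := by
  rw [← h, ← add_assoc, add_self, zero_add]

lemma add_smul_ne_zero : ∀ {x m : Klein} {i : ZMod 2}, x ≠ 0 → (x = m → i = 0) →
    x + i • m ≠ 0 := by
  have : ∀ (x m : Klein) (i : ZMod 2), x ≠ 0 → (x = m → i = 0) → x + i • m ≠ 0 := by decide
  exact fun {x m i} => this x m i

/-- Add `m` to `x` if `x` is not in the subgroup generated by `m` and `i = 1`. -/
def shift (m x : Klein) (i : ZMod 2) : Klein := if x = 0 ∨ x = m then x else x + i • m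

/-- The shift preserves the subgroup generated by `m` and its complement, so `i` and `j` need to
agree only if `x` and `y` are on the same side of this division. -/
lemma shift_ne : ∀ {m x y : Klein} {i j : ZMod 2}, m ≠ 0 → x ≠ y →
    ((x = 0 ∨ x = m ↔ y = 0 ∨ y = m) → i = j) → shift m x i ≠ shift m y j := by
  have : ∀ (m x y : Klein) (i j : ZMod 2), m ≠ 0 → x ≠ y →
    ((x = 0 ∨ x = m ↔ y = 0 ∨ y = m) → i = j) → shift m x i ≠ shift m y j := by decide
  exact fun {m x y i j} => this m x y i j

lemma shift_eq_zero : ∀ {m x : Klein} {i : ZMod 2}, shift m x i = 0 ↔ x = 0 := by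
  have : ∀ (m x : Klein) (i : ZMod 2), shift m x i = 0 ↔ x = 0 := by decide
  exact fun {m x i} => this m x i

end Klein

namespace CubicMap

variable {M : CubicMap}

lemma ne_of_sameVertex {β : Type*} {f : M.Dart → β} (h : ∀ d, f d ≠ f (M.rot d)) {d d' : M.Dart}
    (hs : M.SameVertex d d') (hne : d ≠ d') : f d ≠ f d' := by
  rcases sameVertex_iff.1 hs with rfl | rfl | rfl
  · exact (hne rfl).elim
  · exact h d
  · have := h (M.rot (M.rot d))
    rw [M.rot_rot_rot] at this
    exact this.symm

/-- Colorings are nowhere zero flows with values in the Klein four-group. -/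
lemma isColorable_of_flow {k : M.Dart → Klein} (he : ∀ d, k (M.edge d) = k d)
    (h0 : ∀ d, k d ≠ 0) (hv : ∀ d, k d + k (M.rot d) + k (M.rot (M.rot d)) = 0) :
    M.IsColorable := by
  refine ⟨fun d => Klein.toColor (k d), fun d => congrArg _ (he d), fun d d' hs hne h => ?_⟩
  exact ne_of_sameVertex (fun d => Klein.ne_of_add_eq_zero (hv d) (h0 _)) hs hne
    (Klein.toColor_injective (h0 _) (h0 _) h)

lemma IsColorable.exists_flow (h : M.IsColorable) : ∃ k : M.Dart → Klein,
    (∀ d, k (M.edge d) = k d) ∧ (∀ d, k d ≠ 0) ∧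
      ∀ d, k d + k (M.rot d) + k (M.rot (M.rot d)) = 0 := by
  obtain ⟨color, he, hv⟩ := h
  have h0 : ∀ c : EdgeColor, c.toKlein ≠ 0 := by
    intro c
    cases c <;> decide
  have hinj : ∀ c c' : EdgeColor, c.toKlein = c'.toKlein → c = c' := by
    intro c c'
    cases c <;> cases c' <;> first | exact fun _ => rfl | exact fun h => absurd h (by decide)
  refine ⟨fun d => (color d).toKlein, fun d => congrArg _ (he d), fun d => h0 _, fun d => ?_⟩
  refine Klein.add_eq_zero_of_ne (h0 _) (h0 _) (h0 _) (fun h => ?_) (fun h => ?_) (fun h => ?_)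
  · exact hv _ _ (sameVertex_rot d) (M.rot_ne d).symm (hinj _ _ h)
  · exact hv _ _ (sameVertex_rot _) (M.rot_ne _).symm (hinj _ _ h)
  · exact hv _ _ (sameVertex_iff.2 (by simp)) (rot_rot_ne d).symm (hinj _ _ h)

/-- Two darts satisfying `C` are consecutive on a curve along such darts. -/
def Linked (C : M.Dart → Prop) (d d' : M.Dart) : Prop :=
  C d ∧ C d' ∧ (d' = M.edge d ∨ M.SameVertex d d')

lemma linked_of_reflTransGen {C : M.Dart → Prop} {d d' : M.Dart} (hd : C d)
    (h : Relation.ReflTransGen (Linked C) d d') : C d' := by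
  cases h with
  | refl => exact hd
  | tail _ h => exact h.2.1

lemma linked_symm {C : M.Dart → Prop} {d d' : M.Dart} (h : Linked C d d') : Linked C d' d := by
  refine ⟨h.2.1, h.1, h.2.2.imp (fun h => ?_) SameVertex.symm⟩
  rw [h, M.edge_edge]

lemma reflTransGen_linked_symm {C : M.Dart → Prop} {d d' : M.Dart}
    (h : Relation.ReflTransGen (Linked C) d d') : Relation.ReflTransGen (Linked C) d' d := by
  induction h with
  | refl => exact .refl
  | tail _ h ih => exact .head (linked_symm h) ih

open Classical in
lemma sum_vertex_single (t d : M.Dart) :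
    ((if d = t then 1 else 0) + (if M.rot d = t then 1 else 0) +
      (if M.rot (M.rot d) = t then 1 else 0) : ZMod 2) = if M.SameVertex t d then 1 else 0 := by
  have h : M.SameVertex t d ↔ d = t ∨ M.rot d = t ∨ M.rot (M.rot d) = t := by
    rw [show M.SameVertex t d ↔ M.SameVertex d t from ⟨SameVertex.symm, SameVertex.symm⟩,
      sameVertex_iff, eq_comm, @eq_comm _ t, @eq_comm _ t]
  simp only [h]
  by_cases h1 : d = t
  · subst h1
    simp [M.rot_ne, rot_rot_ne]
  by_cases h2 : M.rot d = t
  · subst h2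
    simp [M.rot_ne, h1]
  simp [h1, h2]

open Classical in
/-- A path along darts satisfying `C` gives a chain modulo `2` whose boundary consists of the ends
of the path. -/
lemma exists_chain {C : M.Dart → Prop} (hC : ∀ d, C d → C (M.edge d)) {s t : M.Dart}
    (h : Relation.ReflTransGen (Linked C) s t) :
    ∃ x : M.Dart → ZMod 2, (∀ d, x (M.edge d) = x d) ∧ (∀ d, ¬ C d → x d = 0) ∧
      ∀ d, x d + x (M.rot d) + x (M.rot (M.rot d)) =
        (if M.SameVertex s d then 1 else 0) + if M.SameVertex t d then 1 else 0 := by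
  induction h with
  | refl => exact ⟨fun _ => 0, fun _ => rfl, fun _ _ => rfl, fun d =>
      (by decide : ∀ y : ZMod 2, 0 + 0 + 0 = y + y) _⟩
  | @tail t t' _ h ih =>
    obtain ⟨x, hxe, hx0, hxv⟩ := ih
    obtain ⟨ht, -, rfl | h⟩ := h
    -- Passing along an edge toggles it in the chain, which moves the second boundary vertex to its
    -- other end.
    · refine ⟨fun d => x d + ((if d = t then 1 else 0) + if d = M.edge t then 1 else 0),
        fun d => ?_, fun d hd => ?_, fun d => ?_⟩
      · have h1 : M.edge d = t ↔ d = M.edge t :=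
          ⟨fun h => by rw [← h, M.edge_edge], fun h => by rw [h, M.edge_edge]⟩
        simp only [hxe, h1, M.edge.injective.eq_iff]
        rw [add_comm (if d = M.edge t then (1 : ZMod 2) else 0)]
      · have h1 : d ≠ t := fun h => hd (h ▸ ht)
        have h2 : d ≠ M.edge t := fun h => hd (h ▸ hC t ht)
        simp only [hx0 d hd, if_neg h1, if_neg h2, add_zero]
      · have h1 := hxv d
        have h2 := sum_vertex_single t d
        have h3 := sum_vertex_single (M.edge t) d
        have h4 : ∀ y : ZMod 2, y + y = 0 := by decide
        have h5 := h4 (if M.SameVertex t d then 1 else 0)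
        linear_combination h1 + h2 + h3 + h5
    · refine ⟨x, hxe, hx0, fun d => ?_⟩
      rw [hxv]
      have : M.SameVertex t d ↔ M.SameVertex t' d :=
        ⟨fun h' => h.symm.trans h', fun h' => h.trans h'⟩
      simp only [this]

/-- If the two ends of the edge of `a` lie on the same two-colored curve of a coloring of the graph
without `a`, the graph is colorable. -/
theorem isColorable_of_reflTransGen {a : M.Dart} (ha : ¬ M.SameVertex a (M.edge a))
    {k : M.Dart → Klein} (he : ∀ d, k (M.edge d) = k d) (h0 : ∀ d, k d = 0 ↔ M.IsOnEdge a d)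
    (hv : ∀ d, k d + k (M.rot d) + k (M.rot (M.rot d)) = 0) {m : Klein} (hm : m ≠ 0)
    (h : Relation.ReflTransGen (Linked fun d => k d ≠ 0 ∧ k d ≠ m) (M.rot a)
      (M.rot (M.edge a))) : M.IsColorable := by
  classical
  obtain ⟨x, hxe, hx0, hxv⟩ := exists_chain (fun d hd => by rwa [he]) h
  -- Add `m` along the path and give `a` the color `m`. At each end of `a` the two contributions of
  -- `m` cancel; no value becomes 0, because the path uses only edges with values other than 0 and
  -- `m`.
  obtain ⟨k', hk'⟩ : ∃ k' : M.Dart → Klein,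
      ∀ d, k' d = if M.IsOnEdge a d then m else k d + x d • m := ⟨_, fun _ => rfl⟩
  have h1 : ∀ d, M.IsOnEdge a d → k' d = m := fun d h => by rw [hk', if_pos h]
  have h2 : ∀ d, ¬ M.IsOnEdge a d → k' d = k d + x d • m := fun d h => by rw [hk', if_neg h]
  have hsv : ∀ d, M.SameVertex (M.rot a) d ↔ M.SameVertex a d := fun d =>
    ⟨(sameVertex_rot a).trans, (sameVertex_rot a).symm.trans⟩
  have hsv' : ∀ d, M.SameVertex (M.rot (M.edge a)) d ↔ M.SameVertex (M.edge a) d := fun d =>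
    ⟨(sameVertex_rot _).trans, (sameVertex_rot _).symm.trans⟩
  simp only [hsv, hsv'] at hxv
  refine isColorable_of_flow (k := k') (fun d => ?_) (fun d => ?_) (fun d => ?_)
  · by_cases hd : M.IsOnEdge a d
    · rw [h1 _ hd, h1 _ (isOnEdge_edge.2 hd)]
    · rw [h2 _ hd, h2 _ (mt isOnEdge_edge.1 hd), he, hxe]
  · by_cases hd : M.IsOnEdge a d
    · rwa [h1 _ hd]
    · rw [h2 _ hd]
      have hk := mt (h0 d).1 hd
      have hx : k d = m → x d = 0 := fun h => hx0 d fun h' => h'.2 h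
      exact Klein.add_smul_ne_zero hk hx
  · have hsum : ∀ p q r : M.Dart, k p + x p • m + (k q + x q • m) + (k r + x r • m) =
        (k p + k q + k r) + (x p + x q + x r) • m := by
      intro p q r
      rw [add_smul, add_smul]
      abel
    by_cases hd : M.IsAtEnd a d
    · obtain ⟨b, hb, hb1, hb2, h3⟩ := hd.exists_eq ha
      have hbk := (h0 b).2 hb
      have hbx := hx0 b fun h => h.1 hbk
      have hone : x b + x (M.rot b) + x (M.rot (M.rot b)) = 1 := by
        rw [hxv]
        rcases hb with rfl | rfl
        · rw [if_pos (.refl _), if_neg (fun h => ha h.symm), add_zero]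
        · rw [if_neg ha, if_pos (.refl _), zero_add]
      have h5 : k' b + k' (M.rot b) + k' (M.rot (M.rot b)) = 0 := by
        have := hsum b (M.rot b) (M.rot (M.rot b))
        rw [hv, hone, hbk, hbx] at this
        rw [h1 _ hb, h2 _ hb1, h2 _ hb2, add_assoc]
        rw [zero_smul, add_zero, zero_add, zero_add, one_smul] at this
        rw [this, Klein.add_self]
      rcases h3 with rfl | rfl | rfl
      · exact h5
      · rw [M.rot_rot_rot, ← h5]
        abel
      · rw [M.rot_rot_rot, ← h5]
        abel
    · have hd1 : ¬ M.IsAtEnd a (M.rot d) := by rwa [isAtEnd_rot]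
      have hd2 : ¬ M.IsAtEnd a (M.rot (M.rot d)) := by rwa [isAtEnd_rot]
      rw [h2 _ (not_isOnEdge_of_not_isAtEnd hd), h2 _ (not_isOnEdge_of_not_isAtEnd hd1),
        h2 _ (not_isOnEdge_of_not_isAtEnd hd2), hsum, hv, hxv, if_neg fun h => hd (Or.inl h),
        if_neg fun h => hd (Or.inr h)]
      simp

end CubicMap

/-! ### Face colorings, regions and Kempe changes. -/

namespace CubicMap

variable {M : CubicMap} {a : M.Dart}

/-- A coloring of the faces of the map without the edge of `a`, in which the face that contains
this edge has the color `0`. -/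
structure IsPotential (a : M.Dart) (c : M.Dart → Klein) : Prop where
  face : ∀ d, c (M.rot d) = c (M.edge d)
  eq_iff : ∀ d, c (M.edge d) = c d ↔ M.IsOnEdge a d
  base : c a = 0

/-- The region of the faces colored `0` and `m`. -/
def Region (c : M.Dart → Klein) (m : Klein) (d : M.Dart) : Prop := c d = 0 ∨ c d = m

/-- The darts on the boundary of a region. -/
def Bd (s : M.Dart → Prop) (d : M.Dart) : Prop := ¬ (s d ↔ s (M.edge d))

lemma bd_edge {s : M.Dart → Prop} {d : M.Dart} : Bd s (M.edge d) ↔ Bd s d := by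
  unfold Bd
  rw [M.edge_edge]
  tauto

/-- Since `{0, m}` is a subgroup of index 2, an edge leaves the region exactly when its flow value
is outside this subgroup. So the boundary consists of the edges on the curves avoiding the color
`m`. -/
lemma bd_region_iff {c : M.Dart → Klein} {m : Klein} (hm : m ≠ 0) {d : M.Dart} :
    Bd (Region c m) d ↔ c d + c (M.edge d) ≠ 0 ∧ c d + c (M.edge d) ≠ m := by
  unfold Bd Region
  generalize c d = x
  generalize c (M.edge d) = y
  revert m x y
  decide

namespace IsPotential

variable {c : M.Dart → Klein}

lemma base_edge (hc : IsPotential a c) : c (M.edge a) = 0 := by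
  rw [(hc.eq_iff a).2 (Or.inl rfl), hc.base]

lemma eq_zero (hc : IsPotential a c) {d : M.Dart} (h : M.IsOnEdge a d) : c d = 0 := by
  rcases h with rfl | rfl
  · exact hc.base
  · exact hc.base_edge

lemma flow_eq_zero (hc : IsPotential a c) (d : M.Dart) :
    c d + c (M.edge d) = 0 ↔ M.IsOnEdge a d := by
  rw [← hc.eq_iff]
  constructor
  · intro h
    rw [Klein.eq_add_of_add_eq h, add_zero]
  · intro h
    rw [h, Klein.add_self]

lemma flow_sum (hc : IsPotential a c) (d : M.Dart) :
    c d + c (M.edge d) + (c (M.rot d) + c (M.edge (M.rot d))) +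
    (c (M.rot (M.rot d)) + c (M.edge (M.rot (M.rot d)))) = 0 := by
  rw [← hc.face, ← hc.face, ← hc.face, M.rot_rot_rot]
  have h0 := Klein.add_self (c d)
  have h1 := Klein.add_self (c (M.rot d))
  have h2 := Klein.add_self (c (M.rot (M.rot d)))
  calc _ = (c d + c d) + (c (M.rot d) + c (M.rot d)) +
        (c (M.rot (M.rot d)) + c (M.rot (M.rot d))) := by abel
    _ = 0 := by rw [h0, h1, h2, add_zero, add_zero]

/-- The two darts at an end of the empty edge border the face of the empty edge. -/
lemma rot_eq_zero (hc : IsPotential a c) {b : M.Dart} (hb : M.IsOnEdge a b) : c (M.rot b) = 0 := by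
  rw [hc.face, hc.eq_zero (isOnEdge_edge.2 hb)]

end IsPotential

lemma region_rot {c : M.Dart → Klein} (hc : ∀ d, c (M.rot d) = c (M.edge d)) {m : Klein}
    (d : M.Dart) : Region c m (M.rot d) ↔ Region c m (M.edge d) := by
  rw [Region, Region, hc]

/-- A flow on a plane graph comes from a face coloring. -/
lemma exists_isPotential (hM : M.CyclesBound) {k : M.Dart → Klein}
    (he : ∀ d, k (M.edge d) = k d) (h0 : ∀ d, k d = 0 ↔ M.IsOnEdge a d)
    (hv : ∀ d, k d + k (M.rot d) + k (M.rot (M.rot d)) = 0) :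
    ∃ c, IsPotential a c ∧ ∀ d, c d + c (M.edge d) = k d := by
  obtain ⟨c1, hc1, hc1'⟩ := hM (fun d => (k d).1) (fun d => by simp only [he])
    (fun d => congrArg Prod.fst (hv d))
  obtain ⟨c2, hc2, hc2'⟩ := hM (fun d => (k d).2) (fun d => by simp only [he])
    (fun d => congrArg Prod.snd (hv d))
  -- The coordinates of the flow bound separately; adding constants normalizes the value at `a` to
  -- 0.
  obtain ⟨c, hcd⟩ : ∃ c : M.Dart → Klein, ∀ d, c d = (c1 d + c1 a, c2 d + c2 a) :=
    ⟨_, fun _ => rfl⟩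
  have hk : ∀ d, c d + c (M.edge d) = k d := by
    intro d
    have h2 : ∀ x y z : ZMod 2, x + z + (x + y + z) = y := by decide
    rw [hcd, hcd, hc1', hc2', Prod.mk_add_mk, h2, h2]
  refine ⟨c, ⟨fun d => by rw [hcd, hcd, hc1, hc2], fun d => ?_, ?_⟩, hk⟩
  · rw [← h0, ← hk d]
    constructor
    · intro h
      rw [h, Klein.add_self]
    · intro h
      rw [Klein.eq_add_of_add_eq h, add_zero]
  · have h2 : ∀ x : ZMod 2, x + x = 0 := by decide
    rw [hcd, h2, h2]
    rfl

-- Going once around a vertex, one enters and leaves `s` an even number of times in all.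
open Classical in
lemma sum_bd_eq_zero {s : M.Dart → Prop} (hs : ∀ d, s (M.rot d) ↔ s (M.edge d)) (d : M.Dart) :
    ((if Bd s d then 1 else 0) + (if Bd s (M.rot d) then 1 else 0) +
      (if Bd s (M.rot (M.rot d)) then 1 else 0) : ZMod 2) = 0 := by
  unfold Bd
  simp only [← hs, M.rot_rot_rot]
  by_cases h1 : s d <;> by_cases h2 : s (M.rot d) <;> by_cases h3 : s (M.rot (M.rot d)) <;>
    simp only [h1, h2, h3] <;> decide

/-- The colors on one side of a two-colored curve can be changed such that the colors along this
curve change, those along a given other curve do not, and the faces colored `0` remain. -/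
theorem IsPotential.exists_shift (hM : M.CyclesBound) {c : M.Dart → Klein} (hc : IsPotential a c)
    {m : Klein} (hm : m ≠ 0) (ht : Bd (Region c m) (M.rot a))
    (h : ¬ Relation.ReflTransGen (Linked (Bd (Region c m))) (M.rot a) (M.rot (M.edge a))) :
    ∃ c', IsPotential a c' ∧ (∀ d, c' d = 0 ↔ c d = 0) ∧
      c' (M.rot a) + c' (M.edge (M.rot a)) = c (M.rot a) + c (M.edge (M.rot a)) + m ∧
      c' (M.rot (M.edge a)) + c' (M.edge (M.rot (M.edge a))) =
        c (M.rot (M.edge a)) + c (M.edge (M.rot (M.edge a))) := by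
  classical
  set S := Region c m with hS
  set K : M.Dart → Prop := Relation.ReflTransGen (Linked (Bd S)) (M.rot a) with hK
  have hKbd : ∀ d, K d → Bd S d := fun d hd => linked_of_reflTransGen ht hd
  have hKe : ∀ d, K d → K (M.edge d) := fun d hd =>
    hd.tail ⟨hKbd d hd, bd_edge.2 (hKbd d hd), Or.inl rfl⟩
  have hKv : ∀ d d', K d → M.SameVertex d d' → Bd S d' → K d' := fun d d' hd hv hd' =>
    hd.tail ⟨hKbd d hd, hd', Or.inr hv⟩
  -- The curve `K` is a cycle modulo 2, since at a vertex that it meets it contains all boundary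
  -- darts. By planarity it bounds a set of faces.
  obtain ⟨I0, hI0, hI0'⟩ := hM (fun d => if K d then 1 else 0) (fun d => by
      have : K (M.edge d) ↔ K d := ⟨fun h => by simpa [M.edge_edge] using hKe _ h, hKe d⟩
      simp only [this]) (fun d => by
      by_cases hd : K d ∨ K (M.rot d) ∨ K (M.rot (M.rot d))
      · have h1 := sameVertex_rot d
        have h2 := sameVertex_rot (M.rot d)
        obtain ⟨e, he, hed⟩ : ∃ e, K e ∧ M.SameVertex e d := by
          rcases hd with hd | hd | hd
          · exact ⟨_, hd, .refl _⟩
          · exact ⟨_, hd, h1.symm⟩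
          · exact ⟨_, hd, (h1.trans h2).symm⟩
        have key : ∀ x, M.SameVertex d x → (K x ↔ Bd S x) := fun x hx =>
          ⟨hKbd x, hKv e x he (hed.trans hx)⟩
        simp only [key _ (.refl d), key _ h1, key _ (h1.trans h2)]
        exact sum_bd_eq_zero (fun d => region_rot hc.face d) d
      · push Not at hd
        simp [hd])
  -- Normalized so that the side of `K` containing `a` is the one left unchanged.
  obtain ⟨I, hId⟩ : ∃ I : M.Dart → ZMod 2, ∀ d, I d = I0 d + I0 a := ⟨_, fun _ => rfl⟩
  have hI : ∀ d, I (M.rot d) = I (M.edge d) := fun d => by rw [hId, hId, hI0]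
  have hIK : ∀ d, ¬ K d → I (M.edge d) = I d := fun d hd => by
    rw [hId, hId, hI0', if_neg hd, add_zero]
  have hIK' : ∀ d, K d → I (M.edge d) = I d + 1 := fun d hd => by
    rw [hId, hId, hI0', if_pos hd]
    ring
  have hIa : I a = 0 := by
    rw [hId]
    exact (by decide : ∀ x : ZMod 2, x + x = 0) _
  have honK : ∀ d, M.IsOnEdge a d → ¬ K d := fun d hd h => by
    have := ((bd_region_iff hm).1 (hKbd d h)).1
    exact this ((hc.flow_eq_zero d).2 hd)
  have hIb : ∀ b, M.IsOnEdge a b → I b = 0 := by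
    rintro b (rfl | rfl)
    · exact hIa
    · rw [hIK _ (honK _ (Or.inl rfl)), hIa]
  -- On the side `I = 1` the two colors outside `{0, m}` are interchanged. Faces inside the region
  -- keep their color; in particular the faces colored 0 stay the same.
  obtain ⟨c', hc'⟩ : ∃ c' : M.Dart → Klein, ∀ d, c' d = Klein.shift m (c d) (I d) :=
    ⟨_, fun _ => rfl⟩
  have hc0 : ∀ d, c' d = 0 ↔ c d = 0 := fun d => by rw [hc', Klein.shift_eq_zero]
  have hshift0 : ∀ x : Klein, Klein.shift m x 0 = x := fun x => by
    unfold Klein.shift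
    split_ifs <;> simp
  refine ⟨c', ⟨fun d => ?_, fun d => ?_, ?_⟩, hc0, ?_, ?_⟩
  · rw [hc', hc', hc.face, hI]
  · rw [hc', hc']
    constructor
    · intro hd
      by_contra hn
      refine Klein.shift_ne hm (fun h => hn ((hc.eq_iff d).1 h)) (fun h => hIK d fun hd => ?_) hd
      exact hKbd d hd ⟨h.2, h.1⟩
    · intro hd
      rw [(hc.eq_iff d).2 hd, hIK d (honK d hd)]
  · rw [hc0, hc.base]
  -- The near face at this end has color 0 and `I = 0`; the far face is outside the region and has
  -- `I = 1`, so exactly the far color changes by `m`.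
  · have h1 : I (M.rot a) = 0 := by rw [hI, hIb _ (Or.inr rfl)]
    have h2 : c (M.rot a) = 0 := hc.rot_eq_zero (Or.inl rfl)
    have h3 := (bd_region_iff hm).1 ht
    rw [hc', hc', h1, hIK' _ .refl, h1, hshift0, h2, zero_add, zero_add, zero_add, Klein.shift,
      if_neg, one_smul]
    rw [h2, zero_add] at h3
    tauto
  · have h1 : I (M.rot (M.edge a)) = 0 := by rw [hI, M.edge_edge, hIa]
    rw [hc', hc', hIK _ h, h1, hshift0, hshift0]

end CubicMap

/-! ### Parity of the number of curves, by signs of permutations. -/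

lemma Set.ncard_image_eq_ncard_image {α β γ : Type*} {A : Set α} {p : α → β} {q : α → γ}
    (h : ∀ x ∈ A, ∀ y ∈ A, p x = p y ↔ q x = q y) : (p '' A).ncard = (q '' A).ncard := by
  have h1 : p '' A = Prod.fst '' ((fun x => (p x, q x)) '' A) := by
    rw [Set.image_image]
  have h2 : q '' A = Prod.snd '' ((fun x => (p x, q x)) '' A) := by
    rw [Set.image_image]
  have i1 : Set.InjOn Prod.fst ((fun x => (p x, q x)) '' A) := by
    rintro _ ⟨x, hx, rfl⟩ _ ⟨y, hy, rfl⟩ hxy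
    exact Prod.ext hxy ((h x hx y hy).1 hxy)
  have i2 : Set.InjOn Prod.snd ((fun x => (p x, q x)) '' A) := by
    rintro _ ⟨x, hx, rfl⟩ _ ⟨y, hy, rfl⟩ hxy
    exact Prod.ext ((h x hx y hy).2 hxy) hxy
  rw [h1, h2, i1.ncard_image, i2.ncard_image]

/-- The sign of a permutation is determined by its number of cycles, fixed points included. -/
lemma Equiv.Perm.sign_eq_neg_one_pow_numOrbits {D : Type} [Fintype D] [DecidableEq D]
    (f : Equiv.Perm D) :
    Equiv.Perm.sign f = (-1) ^ (Fintype.card D + numOrbits f) := by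
  classical
  set p : D → Quotient (Equiv.Perm.SameCycle.setoid f) := Quotient.mk _ with hp
  have hpe : ∀ x y, p x = p y ↔ f.SameCycle x y := fun x y =>
    Quotient.eq (r := Equiv.Perm.SameCycle.setoid f)
  set A : Set D := {x | f x ≠ x} with hA
  have hsupp : ∀ x, x ∈ A ↔ x ∈ f.support := fun x => Equiv.Perm.mem_support.symm
  have hfix : ∀ x y, f x = x → f.SameCycle x y → y = x := by
    rintro x y hx ⟨i, rfl⟩
    exact (Function.IsFixedPt.perm_zpow hx i)
  have h1 : (p '' A).ncard = f.cycleFactorsFinset.card := by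
    rw [Set.ncard_image_eq_ncard_image (q := f.cycleOf), ← Set.ncard_coe_finset]
    · congr 1
      ext g
      simp only [Set.mem_image, Finset.mem_coe]
      constructor
      · rintro ⟨x, hx, rfl⟩
        exact Equiv.Perm.cycleOf_mem_cycleFactorsFinset_iff.2 ((hsupp x).1 hx)
      · intro hg
        obtain ⟨x, hx⟩ := (Equiv.Perm.mem_cycleFactorsFinset_iff.1 hg).1.nonempty_support
        have hgf := (Equiv.Perm.mem_cycleFactorsFinset_support_le hg) hx
        exact ⟨x, (hsupp x).2 hgf, ((Equiv.Perm.cycle_is_cycleOf hx hg)).symm⟩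
    · intro x hx y hy
      rw [hpe]
      exact Equiv.Perm.sameCycle_iff_cycleOf_eq_of_mem_support ((hsupp x).1 hx) ((hsupp y).1 hy)
  have h2 : (p '' Aᶜ).ncard = Aᶜ.ncard := by
    refine Set.InjOn.ncard_image fun x hx y _ hxy => ?_
    exact (hfix x y (not_not.1 hx) ((hpe x y).1 hxy)).symm
  have h3 : (p '' A)ᶜ = p '' Aᶜ := by
    ext q
    obtain ⟨x, rfl⟩ := Quotient.exists_rep q
    constructor
    · intro hq
      exact ⟨x, fun hx => hq ⟨x, hx, rfl⟩, rfl⟩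
    · rintro ⟨y, hy, hyx⟩ ⟨z, hz, hzx⟩
      have h := (hpe y z).1 (hyx.trans hzx.symm)
      exact hz (by rw [hfix y z (not_not.1 hy) h]; exact not_not.1 hy)
  have h4 : numOrbits f = f.cycleType.card + Aᶜ.ncard := by
    rw [numOrbits, ← Set.ncard_univ, ← Set.union_compl_self (p '' A),
      Set.ncard_union_eq disjoint_compl_right (Set.toFinite _) (Set.toFinite _), h3, h1, h2,
      Equiv.Perm.cycleType_def, Multiset.card_map]
    rfl
  have h5 : f.cycleType.sum + Aᶜ.ncard = Fintype.card D := by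
    rw [Equiv.Perm.sum_cycleType, ← Nat.card_eq_fintype_card, ← Set.ncard_add_ncard_compl A,
      ← Set.ncard_coe_finset]
    congr 2
    ext x
    exact (hsupp x).symm
  rw [Equiv.Perm.sign_of_cycleType, ← h5, h4]
  rw [show f.cycleType.sum + Aᶜ.ncard + (f.cycleType.card + Aᶜ.ncard) =
    (f.cycleType.sum + f.cycleType.card) + 2 * Aᶜ.ncard by ring, pow_add _ _ (2 * _), pow_mul]
  simp

namespace CubicMap

variable {M : CubicMap} {a : M.Dart}

open Classical in
/-- Exchange the two darts of each edge inside the region `s`. -/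
noncomputable def swapInside (s : M.Dart → Prop) : Equiv.Perm M.Dart :=
  Function.Involutive.toPerm (fun d => if s d ∧ s (M.edge d) then M.edge d else d) (by
    intro d
    by_cases h : s d ∧ s (M.edge d)
    · simp only [if_pos h, M.edge_edge, if_pos h.symm]
    · simp only [if_neg h])

open Classical in
lemma swapInside_apply (s : M.Dart → Prop) (d : M.Dart) :
    swapInside s d = if s d ∧ s (M.edge d) then M.edge d else d := rfl

/-- Walk along the boundary of the region `s`, or around a vertex inside `s`. -/
noncomputable def walk (s : M.Dart → Prop) : Equiv.Perm M.Dart := M.rot * M.edge * swapInside s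

lemma walk_of_not_bd {s : M.Dart → Prop} {d : M.Dart} (hd : s d) (h : ¬ Bd s d) :
    walk s d = M.rot d := by
  rw [Bd, not_not] at h
  rw [walk, Equiv.Perm.mul_apply, swapInside_apply, if_pos ⟨hd, h.1 hd⟩, Equiv.Perm.mul_apply,
    M.edge_edge]

lemma walk_of_bd {s : M.Dart → Prop} {d : M.Dart} (h : Bd s d) :
    walk s d = M.rot (M.edge d) := by
  rw [walk, Equiv.Perm.mul_apply, swapInside_apply, if_neg fun h' => h (by tauto),
    Equiv.Perm.mul_apply]

section walk

variable {s : M.Dart → Prop}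

lemma apply_face (hs : ∀ d, s (M.rot d) ↔ s (M.edge d)) (d : M.Dart) :
    s ((M.rot * M.edge) d) ↔ s d := by
  rw [Equiv.Perm.mul_apply, hs, M.edge_edge]

lemma apply_swapInside (d : M.Dart) : s (swapInside s d) ↔ s d := by
  rw [swapInside_apply]
  split_ifs with h
  · tauto
  · rfl

lemma apply_walk (hs : ∀ d, s (M.rot d) ↔ s (M.edge d)) (d : M.Dart) : s (walk s d) ↔ s d := by
  rw [walk, Equiv.Perm.mul_apply, apply_face hs]
  exact apply_swapInside d

/-- Between two boundary darts, a walk has at most one interior dart, at a vertex with one edge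
inside the region; `key` records that the next dart is then again on the same curve. -/
lemma reflTransGen_of_sameCycle (hs : ∀ d, s (M.rot d) ↔ s (M.edge d)) {x y : M.Dart}
    (hx : s x) (hxb : Bd s x) (hyb : Bd s y) (h : (walk s).SameCycle x y) :
    Relation.ReflTransGen (Linked (Bd s)) x y := by
  set R := Relation.ReflTransGen (Linked (Bd s)) x with hR
  have key : ∀ n : ℕ, s ((walk s ^ n) x) ∧ (Bd s ((walk s ^ n) x) ∧ R ((walk s ^ n) x) ∨
      ¬ Bd s ((walk s ^ n) x) ∧ Bd s (M.rot ((walk s ^ n) x)) ∧ R (M.rot ((walk s ^ n) x))) := by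
    intro n
    induction n with
    | zero => exact ⟨hx, Or.inl ⟨hxb, .refl⟩⟩
    | succ n ih =>
      rw [pow_succ', Equiv.Perm.mul_apply]
      generalize (walk s ^ n) x = d at ih ⊢
      refine ⟨(apply_walk hs d).2 ih.1, ?_⟩
      obtain ⟨hd, ⟨hb, hr⟩ | ⟨hb, hb', hr⟩⟩ := ih
      · rw [walk_of_bd hb]
        have he : R (M.edge d) := hr.tail ⟨hb, bd_edge.2 hb, Or.inl rfl⟩
        have hns : ¬ s (M.edge d) := fun h => hb (by tauto)
        by_cases h1 : Bd s (M.rot (M.edge d))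
        · exact Or.inl ⟨h1, he.tail ⟨bd_edge.2 hb, h1, Or.inr (sameVertex_rot _)⟩⟩
        · have h2 : Bd s (M.rot (M.rot (M.edge d))) := by
            intro h2
            rw [← hs, M.rot_rot_rot, hs] at h2
            refine hns (h2.1 ?_)
            rw [Bd, not_not] at h1
            refine h1.1 ?_
            rwa [hs, M.edge_edge]
          exact Or.inr ⟨h1, h2, he.tail ⟨bd_edge.2 hb, h2, Or.inr (sameVertex_iff.2 (by simp))⟩⟩
      · rw [walk_of_not_bd hd hb]
        exact Or.inl ⟨hb', hr⟩
  obtain ⟨n, rfl⟩ := h.exists_nat_pow_eq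
  rcases (key n).2 with h | h
  · exact h.2
  · exact (h.1 hyb).elim

/-- Each boundary edge has exactly one dart in `s`, selected by `f`. Consecutive edges of a curve
have selected darts one or two steps of the walk apart. -/
lemma sameCycle_of_linked (hs : ∀ d, s (M.rot d) ↔ s (M.edge d)) {x y : M.Dart}
    (hx : s x) (hy : s y) (h : Relation.ReflTransGen (Linked (Bd s)) x y) :
    (walk s).SameCycle x y := by
  classical
  set f : M.Dart → M.Dart := fun d => if s d then d else M.edge d with hf
  have f1 : ∀ d, s d → f d = d := fun d h => if_pos h
  have f0 : ∀ d, ¬ s d → f d = M.edge d := fun d h => if_neg h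
  have step : ∀ d, (walk s).SameCycle d (walk s d) := fun d =>
    Equiv.Perm.sameCycle_apply_right.2 (.refl _ _)
  have hrot : ∀ d, Bd s d → Bd s (M.rot d) → (walk s).SameCycle (f d) (f (M.rot d)) := by
    intro d h1 h2
    by_cases hd : s d
    · have h3 : ¬ s (M.edge d) := fun h => h1 (by tauto)
      have h4 : ¬ s (M.rot d) := by rwa [hs]
      have h5 : s (M.edge (M.rot d)) := by
        by_contra h5
        exact h2 (by tauto)
      rw [f1 d hd, f0 _ h4]
      have h6 : s (M.rot (M.rot d)) := by rwa [hs]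
      have h7 : ¬ Bd s (M.rot (M.rot d)) := by
        rw [Bd, ← hs, M.rot_rot_rot]
        tauto
      have s1 := step (M.edge (M.rot d))
      rw [walk_of_bd (bd_edge.2 h2), M.edge_edge] at s1
      have s2 := step (M.rot (M.rot d))
      rw [walk_of_not_bd h6 h7, M.rot_rot_rot] at s2
      exact (s1.trans s2).symm
    · have h3 : s (M.edge d) := by
        by_contra h3
        exact h1 (by tauto)
      have h4 : s (M.rot d) := by rwa [hs]
      rw [f0 d hd, f1 _ h4]
      have s1 := step (M.edge d)
      rwa [walk_of_bd (bd_edge.2 h1), M.edge_edge] at s1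
  have key : (walk s).SameCycle (f x) (f y) := by
    clear hy
    induction h with
    | refl => exact .refl _ _
    | @tail d d' _ h ih =>
      refine ih.trans ?_
      obtain ⟨h1, h2, rfl | h3⟩ := h
      · by_cases hd : s d
        · rw [f1 d hd, f0 _ fun h => h1 (by tauto), M.edge_edge]
        · rw [f0 d hd, f1]
          by_contra h3
          exact h1 (by tauto)
      · rcases sameVertex_iff.1 h3 with rfl | rfl | rfl
        · exact .refl _ _
        · exact hrot d h1 h2
        · have := hrot _ h2 (by rwa [M.rot_rot_rot])
          rw [M.rot_rot_rot] at this
          exact this.symm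
  rwa [f1 x hx, f1 y hy] at key

/-- The closed curves along the darts satisfying `C`. -/
def curveSets (C : M.Dart → Prop) : Set (Set M.Dart) :=
  {S | ∃ d, C d ∧ S = {d' | Relation.ReflTransGen (Linked C) d d'}}

lemma setOf_reflTransGen_eq_iff {C : M.Dart → Prop} {x y : M.Dart} :
    {d | Relation.ReflTransGen (Linked C) x d} = {d | Relation.ReflTransGen (Linked C) y d} ↔
      Relation.ReflTransGen (Linked C) x y := by
  constructor
  · intro h
    have : y ∈ {d | Relation.ReflTransGen (Linked C) y d} := .refl
    rwa [← h] at this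
  · intro h
    ext d
    exact ⟨(reflTransGen_linked_symm h).trans, h.trans⟩

end walk

end CubicMap

namespace CubicMap

variable {M : CubicMap} {a : M.Dart}

section region

variable {s : M.Dart → Prop}

/-- The number of closed walks in the region `s`. -/
noncomputable def numWalks (s : M.Dart → Prop) (hs : ∀ d, s (M.rot d) ↔ s (M.edge d)) : ℕ :=
  numOrbits ((walk s).subtypePerm (apply_walk hs))

/-- The closed walks in a region are its boundary curves and the walks around its interior
vertices; the latter are represented by the set `E`. -/
lemma numWalks_eq (hs : ∀ d, s (M.rot d) ↔ s (M.edge d)) (E : Set M.Dart)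
    (hE : ∀ b ∈ E, s b ∧ ¬ Bd s b ∧ ¬ Bd s (M.rot b))
    (hE' : ∀ b ∈ E, ∀ b' ∈ E, M.SameVertex b b' → b = b')
    (hEx : ∀ d, s d → ¬ Bd s d → ¬ Bd s (M.rot d) → ∃ b ∈ E, M.SameVertex b d) :
    numWalks s hs = (curveSets (Bd s)).ncard + E.ncard := by
  classical
  set π : Equiv.Perm {d // s d} := (walk s).subtypePerm (apply_walk hs) with hπ
  set p : {d // s d} → Quotient (Equiv.Perm.SameCycle.setoid π) := Quotient.mk _ with hp
  have hpe : ∀ x y, p x = p y ↔ (walk s).SameCycle x.1 y.1 := fun x y =>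
    (Quotient.eq (r := Equiv.Perm.SameCycle.setoid π)).trans Equiv.Perm.sameCycle_subtypePerm
  set A : Set {d // s d} := {x | Bd s x.1} with hA
  have third : ∀ d, s d → ¬ Bd s d → ¬ Bd s (M.rot d) →
      s (M.rot d) ∧ s (M.rot (M.rot d)) ∧ ¬ Bd s (M.rot (M.rot d)) := by
    intro d h0 h1 h2
    rw [Bd, not_not] at h1 h2 ⊢
    have h3 : s (M.rot d) := by rw [hs]; exact h1.1 h0
    have h4 : s (M.rot (M.rot d)) := by rw [hs]; exact h2.1 h3
    refine ⟨h3, h4, ?_⟩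
    rw [← hs, M.rot_rot_rot]
    tauto
  -- around an interior vertex
  have around : ∀ d, s d → ¬ Bd s d → ¬ Bd s (M.rot d) → ∀ x,
      (walk s).SameCycle d x ↔ M.SameVertex d x := by
    intro d h0 h1 h2 x
    obtain ⟨h3, h4, h5⟩ := third d h0 h1 h2
    have w1 := walk_of_not_bd h0 h1
    have w2 := walk_of_not_bd h3 h2
    have w3 := walk_of_not_bd h4 h5
    have s1 : (walk s).SameCycle d (M.rot d) := by
      rw [← w1]; exact Equiv.Perm.sameCycle_apply_right.2 (.refl _ _)
    have s2 : (walk s).SameCycle (M.rot d) (M.rot (M.rot d)) := by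
      rw [← w2]; exact Equiv.Perm.sameCycle_apply_right.2 (.refl _ _)
    constructor
    · intro h
      obtain ⟨n, rfl⟩ := h.exists_nat_pow_eq
      rw [sameVertex_iff]
      induction n with
      | zero => exact Or.inl rfl
      | succ n ih =>
        rw [pow_succ', Equiv.Perm.mul_apply]
        rcases ih ⟨n, by simp⟩ with h | h | h
        · rw [h, w1]; simp
        · rw [h, w2]; simp
        · rw [h, w3, M.rot_rot_rot]; simp
    · rw [sameVertex_iff]
      rintro (rfl | rfl | rfl)
      · exact .refl _ _
      · exact s1
      · exact s1.trans s2
  have h1 : (p '' A).ncard = (curveSets (Bd s)).ncard := by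
    rw [Set.ncard_image_eq_ncard_image
      (q := fun x => {d | Relation.ReflTransGen (Linked (Bd s)) x.1 d})]
    · congr 1
      ext S
      constructor
      · rintro ⟨x, hx, rfl⟩
        exact ⟨x.1, hx, rfl⟩
      · rintro ⟨d, hd, rfl⟩
        by_cases hsd : s d
        · exact ⟨⟨d, hsd⟩, hd, rfl⟩
        · have hse : s (M.edge d) := by
            by_contra h
            exact hd (by tauto)
          refine ⟨⟨M.edge d, hse⟩, bd_edge.2 hd, ?_⟩
          exact setOf_reflTransGen_eq_iff.2
            (.single ⟨bd_edge.2 hd, hd, Or.inl (M.edge_edge d).symm⟩)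
    · intro x hx y hy
      rw [hpe, setOf_reflTransGen_eq_iff]
      exact ⟨reflTransGen_of_sameCycle hs x.2 hx hy, sameCycle_of_linked hs x.2 y.2⟩
  set B : Set {d // s d} := {x | x.1 ∈ E} with hB
  have h2 : (p '' A)ᶜ = p '' B := by
    ext q
    obtain ⟨x, rfl⟩ := Quotient.exists_rep q
    constructor
    · intro hq
      have hx : ¬ Bd s x.1 := fun hx => hq ⟨x, hx, rfl⟩
      have hx' : ¬ Bd s (M.rot x.1) := by
        intro hx'
        have hsr : s (M.rot x.1) := by
          rw [Bd, not_not] at hx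
          rw [hs]
          exact hx.1 x.2
        refine hq ⟨⟨M.rot x.1, hsr⟩, hx', (hpe _ _).2 ?_⟩
        have : M.rot x.1 = walk s x.1 := (walk_of_not_bd x.2 hx).symm
        change (walk s).SameCycle (M.rot x.1) x.1
        rw [this]
        exact Equiv.Perm.sameCycle_apply_left.2 (.refl _ _)
      obtain ⟨b, hb, hbx⟩ := hEx x.1 x.2 hx hx'
      obtain ⟨h3, h4, h5⟩ := hE b hb
      exact ⟨⟨b, h3⟩, hb, (hpe _ _).2 ((around b h3 h4 h5 x.1).2 hbx)⟩
    · rintro ⟨b, hb, hbx⟩ ⟨y, hy, hyx⟩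
      obtain ⟨h3, h4, h5⟩ := hE b.1 hb
      have h6 := (around b.1 h3 h4 h5 y.1).1 ((hpe _ _).1 (hbx.trans hyx.symm))
      have hy' : Bd s y.1 := hy
      rcases sameVertex_iff.1 h6 with h | h | h <;> rw [h] at hy'
      · exact h4 hy'
      · exact h5 hy'
      · exact (third b.1 h3 h4 h5).2.2 hy'
  have h3 : (p '' B).ncard = E.ncard := by
    rw [Set.InjOn.ncard_image]
    · rw [← Set.InjOn.ncard_image (f := Subtype.val) Subtype.val_injective.injOn]
      congr 1
      ext b
      constructor
      · rintro ⟨x, hx, rfl⟩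
        exact hx
      · intro hb
        exact ⟨⟨b, (hE b hb).1⟩, hb, rfl⟩
    · intro x hx y hy hxy
      obtain ⟨h3, h4, h5⟩ := hE x.1 hx
      exact Subtype.ext (hE' _ hx _ hy ((around x.1 h3 h4 h5 y.1).1 ((hpe _ _).1 hxy)))
  rw [numWalks, numOrbits, ← Set.ncard_univ, ← Set.union_compl_self (p '' A),
      Set.ncard_union_eq disjoint_compl_right (Set.toFinite _) (Set.toFinite _), h2, h1, h3]

-- The walk is the face permutation composed with the exchange inside `s`, and its sign counts its
-- orbits modulo 2. The exchange moves only darts in `s`, so restriction does not affect its sign.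
open Classical in
lemma sign_numWalks (hs : ∀ d, s (M.rot d) ↔ s (M.edge d)) :
    (-1 : ℤˣ) ^ ({d | s d}.ncard + numWalks s hs) =
      Equiv.Perm.sign ((M.rot * M.edge).subtypePerm (apply_face hs)) *
        Equiv.Perm.sign (swapInside s) := by
  have h : (walk s).subtypePerm (apply_walk hs) =
      (M.rot * M.edge).subtypePerm (apply_face hs) *
        (swapInside s).subtypePerm (fun d => apply_swapInside d) := by
    ext d
    rfl
  have h1 : Equiv.Perm.sign ((swapInside s).subtypePerm (fun d => apply_swapInside d)) =
      Equiv.Perm.sign (swapInside s) := by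
    refine Equiv.Perm.sign_subtypePerm _ _ fun x hx => ?_
    by_contra h
    refine hx ?_
    rw [swapInside_apply, if_neg fun h' => h h'.1]
  rw [← h1, ← Equiv.Perm.sign_mul, ← h, Equiv.Perm.sign_eq_neg_one_pow_numOrbits, numWalks,
    ← Nat.card_eq_fintype_card]
  rfl

end region

open Classical in
/-- The face permutation restricted to a set of faces. -/
noncomputable def faceOn (s : M.Dart → Prop) (hs : ∀ d, s (M.rot d) ↔ s (M.edge d)) :
    Equiv.Perm M.Dart := Equiv.Perm.ofSubtype ((M.rot * M.edge).subtypePerm (apply_face hs))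

open Classical in
lemma faceOn_apply {s : M.Dart → Prop} (hs : ∀ d, s (M.rot d) ↔ s (M.edge d)) (d : M.Dart) :
    faceOn s hs d = if s d then M.rot (M.edge d) else d := by
  unfold faceOn
  split_ifs with h
  · rw [Equiv.Perm.ofSubtype_apply_of_mem _ h]
    rfl
  · rw [Equiv.Perm.ofSubtype_apply_of_not_mem _ h]

open Classical in
lemma sign_faceOn {s : M.Dart → Prop} (hs : ∀ d, s (M.rot d) ↔ s (M.edge d)) :
    Equiv.Perm.sign (faceOn s hs) =
      Equiv.Perm.sign ((M.rot * M.edge).subtypePerm (apply_face hs)) :=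
  Equiv.Perm.sign_ofSubtype _

lemma colorClass_rot {c : M.Dart → Klein} (hc : ∀ d, c (M.rot d) = c (M.edge d)) (m : Klein)
    (d : M.Dart) : c (M.rot d) = m ↔ c (M.edge d) = m := by
  rw [hc]

lemma faceOn_region {c : M.Dart → Klein} (hc : ∀ d, c (M.rot d) = c (M.edge d)) {m : Klein}
    (hm : m ≠ 0) : faceOn (Region c m) (region_rot hc) =
      faceOn (fun d => c d = 0) (colorClass_rot hc 0) *
        faceOn (fun d => c d = m) (colorClass_rot hc m) := by
  classical
  have hf : ∀ d, c (M.rot (M.edge d)) = c d := fun d => by rw [hc, M.edge_edge]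
  ext d
  rw [Equiv.Perm.mul_apply, faceOn_apply, faceOn_apply, faceOn_apply]
  unfold Region
  by_cases h : c d = m
  · rw [if_pos (Or.inr h), if_pos h, if_neg]
    rwa [hf, h]
  · simp [h]

lemma faceOn_mul {c : M.Dart → Klein} (hc : ∀ d, c (M.rot d) = c (M.edge d)) :
    faceOn (fun d => c d = 0) (colorClass_rot hc 0) *
      faceOn (fun d => c d = (1, 0)) (colorClass_rot hc _) *
      faceOn (fun d => c d = (0, 1)) (colorClass_rot hc _) *
      faceOn (fun d => c d = (1, 1)) (colorClass_rot hc _) = M.rot * M.edge := by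
  classical
  have hf : ∀ d, c (M.rot (M.edge d)) = c d := fun d => by rw [hc, M.edge_edge]
  have hcases : ∀ x : Klein, x = 0 ∨ x = (1, 0) ∨ x = (0, 1) ∨ x = (1, 1) := by decide
  ext d
  simp only [Equiv.Perm.mul_apply, faceOn_apply]
  have n1 : (0 : Klein) ≠ (1, 0) := by decide
  have n2 : (0 : Klein) ≠ (0, 1) := by decide
  have n3 : (0 : Klein) ≠ (1, 1) := by decide
  rcases hcases (c d) with h | h | h | h <;> simp [h, hf, n1, n2, n3]

/-- The product of the exchanges inside the three regions around the faces colored `0` only depends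
on these faces. -/
lemma IsPotential.swapInside_mul {c : M.Dart → Klein} (hc : IsPotential a c) (d : M.Dart) :
    (swapInside (Region c (1, 0)) * swapInside (Region c (0, 1)) *
      swapInside (Region c (1, 1))) d = (open Classical in
        if c d = 0 ∨ c (M.edge d) = 0 then M.edge d else d) := by
  classical
  simp only [Equiv.Perm.mul_apply, swapInside_apply, Region]
  -- Equal colors on both sides occur only on `a`, where they are 0 and the edge is exchanged in all
  -- three regions. Any other edge is exchanged in exactly one region if one side is 0, and in none
  -- otherwise.
  have h := fun h => hc.eq_zero ((hc.eq_iff d).1 h)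
  have hcases : ∀ x : Klein, x = 0 ∨ x = (1, 0) ∨ x = (0, 1) ∨ x = (1, 1) := by decide
  rcases hcases (c d) with h1 | h1 | h1 | h1 <;>
    rcases hcases (c (M.edge d)) with h2 | h2 | h2 | h2 <;>
    first
      | exact absurd (h (h2.trans h1.symm)) (by rw [h1]; decide)
      | simp [h1, h2, M.edge_edge]

/-- The parity of the number of closed walks only depends on the faces colored `0`. -/
theorem IsPotential.even_numWalks_add {c c' : M.Dart → Klein} (hc : IsPotential a c)
    (hc' : IsPotential a c') (h0 : ∀ d, c' d = 0 ↔ c d = 0) :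
    Even (numWalks (Region c (1, 0)) (region_rot hc.face) +
      numWalks (Region c (0, 1)) (region_rot hc.face) +
      numWalks (Region c (1, 1)) (region_rot hc.face) +
      (numWalks (Region c' (1, 0)) (region_rot hc'.face) +
      numWalks (Region c' (0, 1)) (region_rot hc'.face) +
      numWalks (Region c' (1, 1)) (region_rot hc'.face))) := by
  classical
  have hswap : swapInside (Region c (1, 0)) * swapInside (Region c (0, 1)) *
      swapInside (Region c (1, 1)) = swapInside (Region c' (1, 0)) *
        swapInside (Region c' (0, 1)) * swapInside (Region c' (1, 1)) := by
    ext d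
    rw [hc.swapInside_mul, hc'.swapInside_mul]
    simp only [h0]
  have key : ∀ c : M.Dart → Klein, ∀ hc : IsPotential a c,
      (-1 : ℤˣ) ^ (numWalks (Region c (1, 0)) (region_rot hc.face) +
      numWalks (Region c (0, 1)) (region_rot hc.face) +
      numWalks (Region c (1, 1)) (region_rot hc.face)) =
      (-1) ^ Fintype.card M.Dart * (Equiv.Perm.sign (M.rot * M.edge) *
        Equiv.Perm.sign (swapInside (Region c (1, 0)) * swapInside (Region c (0, 1)) *
      swapInside (Region c (1, 1)))) := by
    intro c hc
    -- The faces colored 0 belong to all three regions, so the total agrees modulo 2 with the number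
    -- of darts.
    have hcard : ({d | Region c (1, 0) d}.ncard + {d | Region c (0, 1) d}.ncard +
        {d | Region c (1, 1) d}.ncard) = Fintype.card M.Dart + 2 * {d | c d = 0}.ncard := by
      have hadd : ∀ m : Klein, m ≠ 0 →
          {d | Region c m d}.ncard = {d | c d = 0}.ncard + {d | c d = m}.ncard := by
        intro m hm
        rw [← Set.ncard_union_eq _ (Set.toFinite _) (Set.toFinite _)]
        · rfl
        · rw [Set.disjoint_left]
          intro d h1 h2
          exact hm (h2.symm.trans h1)
      rw [hadd _ (by decide), hadd _ (by decide), hadd _ (by decide)]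
      have htot : Fintype.card M.Dart = {d | c d = 0}.ncard + {d | c d = (1, 0)}.ncard +
          {d | c d = (0, 1)}.ncard + {d | c d = (1, 1)}.ncard := by
        simp only [Set.ncard_eq_toFinset_card', Set.toFinset_ofPred]
        rw [← Finset.card_univ, Finset.card_eq_sum_card_fiberwise (f := c) (t := Finset.univ)
          (fun _ _ => Finset.mem_univ _)]
        rw [show (Finset.univ : Finset Klein) = {0, (1, 0), (0, 1), (1, 1)} by decide]
        rw [Finset.sum_insert (by decide), Finset.sum_insert (by decide),
          Finset.sum_insert (by decide), Finset.sum_singleton]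
        ring
      omega
    have s1 := sign_numWalks (s := Region c (1, 0)) (region_rot hc.face)
    have s2 := sign_numWalks (s := Region c (0, 1)) (region_rot hc.face)
    have s3 := sign_numWalks (s := Region c (1, 1)) (region_rot hc.face)
    rw [← sign_faceOn (region_rot hc.face), faceOn_region hc.face (by decide),
      Equiv.Perm.sign_mul] at s1
    rw [← sign_faceOn (region_rot hc.face), faceOn_region hc.face (by decide),
      Equiv.Perm.sign_mul] at s2
    rw [← sign_faceOn (region_rot hc.face), faceOn_region hc.face (by decide),
      Equiv.Perm.sign_mul] at s3
    have hprod := congrArg Equiv.Perm.sign (faceOn_mul hc.face)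
    simp only [Equiv.Perm.sign_mul] at hprod
    rw [Equiv.Perm.sign_mul, Equiv.Perm.sign_mul, Equiv.Perm.sign_mul, ← hprod]
    -- The sign on the faces colored 0 occurs three times; a square cancels, and what remains is the
    -- sign of the full face permutation.
    have hsq := Int.units_mul_self
      (Equiv.Perm.sign (faceOn (fun d => c d = 0) (colorClass_rot hc.face 0)))
    have hmul := congrArg₂ (· * ·) (congrArg₂ (· * ·) s1 s2) s3
    simp only [← pow_add] at hmul
    rw [show {d | Region c (1, 0) d}.ncard + numWalks (Region c (1, 0)) (region_rot hc.face) +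
      ({d | Region c (0, 1) d}.ncard + numWalks (Region c (0, 1)) (region_rot hc.face)) +
      ({d | Region c (1, 1) d}.ncard + numWalks (Region c (1, 1)) (region_rot hc.face)) =
      (numWalks (Region c (1, 0)) (region_rot hc.face) +
      numWalks (Region c (0, 1)) (region_rot hc.face) +
      numWalks (Region c (1, 1)) (region_rot hc.face)) +
      ({d | Region c (1, 0) d}.ncard + {d | Region c (0, 1) d}.ncard +
        {d | Region c (1, 1) d}.ncard) by ring, hcard, pow_add, pow_add _ _ (2 * _), pow_mul _ 2,
        show (-1 : ℤˣ) ^ 2 = 1 by rfl, one_pow, mul_one] at hmul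
    have hsq' := Int.units_mul_self ((-1 : ℤˣ) ^ Fintype.card M.Dart)
    generalize (-1 : ℤˣ) ^ Fintype.card M.Dart = u at *
    generalize (-1 : ℤˣ) ^ (numWalks (Region c (1, 0)) (region_rot hc.face) +
      numWalks (Region c (0, 1)) (region_rot hc.face) +
      numWalks (Region c (1, 1)) (region_rot hc.face)) = w at *
    rw [← mul_one w, ← hsq', ← mul_assoc, hmul, mul_comm _ u]
    congr 1
    generalize Equiv.Perm.sign (faceOn (fun d => c d = 0) (colorClass_rot hc.face 0)) = z at *
    conv_rhs => rw [← one_mul (_ * _), ← hsq]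
    ac_rfl
  have h := (key c hc).trans ((hswap ▸ (key c' hc').symm))
  have h2 : (-1 : ℤˣ) ^ (numWalks (Region c (1, 0)) (region_rot hc.face) +
      numWalks (Region c (0, 1)) (region_rot hc.face) +
      numWalks (Region c (1, 1)) (region_rot hc.face) +
      (numWalks (Region c' (1, 0)) (region_rot hc'.face) +
      numWalks (Region c' (0, 1)) (region_rot hc'.face) +
      numWalks (Region c' (1, 1)) (region_rot hc'.face))) = 1 := by
    rw [pow_add, h, Int.units_mul_self]
  by_contra hodd
  rw [Nat.not_even_iff_odd] at hodd
  rw [hodd.neg_one_pow] at h2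
  exact absurd h2 (by decide)

end CubicMap

/-! ### Formations from face colorings, and their free curves. -/

/-- The color that a kind of curves avoids. -/
def CurveKind.missing : CurveKind → Klein
  | .red => (0, 1)
  | .blue => (1, 0)
  | .alternating => (1, 1)

lemma CurveKind.missing_ne (k : CurveKind) : k.missing ≠ 0 := by
  cases k <;> decide

lemma CurveKind.uses_toColor (k : CurveKind) {x : Klein} (hx : x ≠ 0) :
    k.Uses (Klein.toColor x) ↔ x ≠ k.missing := by
  have hcases : ∀ x : Klein, x ≠ 0 → x = (1, 0) ∨ x = (0, 1) ∨ x = (1, 1) := by decide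
  have e1 : Klein.toColor (1, 0) = .red := rfl
  have e2 : Klein.toColor (0, 1) = .blue := rfl
  have e3 : Klein.toColor (1, 1) = .purple := rfl
  cases k <;> rcases hcases x hx with rfl | rfl | rfl <;>
    simp [CurveKind.Uses, CurveKind.missing, e1, e2, e3]

namespace CubicMap

variable {M : CubicMap} {a : M.Dart} {c : M.Dart → Klein}

/-- The formation given by a face coloring. -/
def IsPotential.formation (hc : IsPotential a c) (ha : ¬ M.SameVertex a (M.edge a)) :
    Formation M a where
  color d := Klein.toColor (c d + c (M.edge d))
  color_edge d _ := by rw [M.edge_edge, add_comm]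
  color_vertex d d' hd hs hne h := by
    have h0 : ∀ x, ¬ M.IsAtEnd a x → c x + c (M.edge x) ≠ 0 := fun x hx hx' =>
      not_isOnEdge_of_not_isAtEnd hx ((hc.flow_eq_zero x).1 hx')
    have h1 : ¬ M.IsAtEnd a (M.rot d) := by rwa [isAtEnd_rot]
    have h2 : ¬ M.IsAtEnd a (M.rot (M.rot d)) := by rwa [isAtEnd_rot]
    have hsum := hc.flow_sum d
    rcases sameVertex_iff.1 hs with rfl | rfl | rfl
    · exact hne rfl
    · exact Klein.ne_of_add_eq_zero hsum (h0 _ h2) (Klein.toColor_injective (h0 _ hd) (h0 _ h1) h)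
    · rw [add_right_comm] at hsum
      exact Klein.ne_of_add_eq_zero hsum (h0 _ h1) (Klein.toColor_injective (h0 _ hd) (h0 _ h2) h)
  color_end d d' hd hd' he hs := by
    obtain ⟨b, hb, hb1, hb2, h⟩ := he.exists_eq ha
    have hsum := hc.flow_sum b
    rw [(hc.flow_eq_zero b).2 hb, zero_add] at hsum
    have heq := Klein.eq_add_of_add_eq hsum
    rw [add_zero] at heq
    have key : ∀ x, M.SameVertex b x → ¬ M.IsOnEdge a x →
        c x + c (M.edge x) = c (M.rot b) + c (M.edge (M.rot b)) := by
      intro x hx hx'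
      rcases sameVertex_iff.1 hx with rfl | rfl | rfl
      · exact (hx' hb).elim
      · rfl
      · exact heq
    have hbd : M.SameVertex b d := sameVertex_iff.2 h
    rw [key d hbd hd, key d' (hbd.trans hs) hd']

lemma IsPotential.formation_color (hc : IsPotential a c)
    (ha : ¬ M.SameVertex a (M.edge a)) (d : M.Dart) :
    (hc.formation ha).color d = Klein.toColor (c d + c (M.edge d)) := rfl

lemma IsPotential.carries_iff (hc : IsPotential a c)
    (ha : ¬ M.SameVertex a (M.edge a)) (k : CurveKind) (d : M.Dart) :
    (hc.formation ha).Carries k d ↔ Bd (Region c k.missing) d := by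
  rw [bd_region_iff k.missing_ne, Formation.Carries, ← hc.flow_eq_zero]
  refine and_congr_right fun h => ?_
  exact k.uses_toColor h

lemma IsPotential.step_eq (hc : IsPotential a c)
    (ha : ¬ M.SameVertex a (M.edge a)) (k : CurveKind) :
    (hc.formation ha).Step k = Linked (Bd (Region c k.missing)) := by
  funext d d'
  simp only [Formation.Step, Linked, hc.carries_iff ha]

lemma IsPotential.curveThrough_eq (hc : IsPotential a c)
    (ha : ¬ M.SameVertex a (M.edge a)) (k : CurveKind) (d : M.Dart) :
    (hc.formation ha).curveThrough k d =
      {d' | Relation.ReflTransGen (Linked (Bd (Region c k.missing))) d d'} := by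
  rw [Formation.curveThrough, hc.step_eq]

/-- The curves that pass through neither end of the edge of `a`. -/
def freeSets (a : M.Dart) (C : M.Dart → Prop) : Set (Set M.Dart) :=
  {S | S ∈ curveSets C ∧ ∀ d ∈ S, ¬ M.IsAtEnd a d}

lemma IsPotential.mem_freeCurves_iff (hc : IsPotential a c)
    (ha : ¬ M.SameVertex a (M.edge a)) (k : CurveKind) (S : Set M.Dart) :
    (k, S) ∈ (hc.formation ha).freeCurves ↔ S ∈ freeSets a (Bd (Region c k.missing)) := by
  simp only [Formation.freeCurves, Formation.curves, freeSets, curveSets, Set.mem_ofPred_eq,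
    hc.carries_iff ha, hc.curveThrough_eq ha]

lemma IsPotential.ncard_freeCurves (hc : IsPotential a c)
    (ha : ¬ M.SameVertex a (M.edge a)) : (hc.formation ha).freeCurves.ncard =
    (freeSets a (Bd (Region c (1, 0)))).ncard + (freeSets a (Bd (Region c (0, 1)))).ncard +
      (freeSets a (Bd (Region c (1, 1)))).ncard := by
  have hinj : ∀ k : CurveKind, Function.Injective (Prod.mk k : Set M.Dart → _) :=
    fun k => Prod.mk_right_injective k
  have h : (hc.formation ha).freeCurves =
      Prod.mk CurveKind.blue '' freeSets a (Bd (Region c (1, 0))) ∪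
      Prod.mk CurveKind.red '' freeSets a (Bd (Region c (0, 1))) ∪
      Prod.mk CurveKind.alternating '' freeSets a (Bd (Region c (1, 1))) := by
    ext ⟨k, S⟩
    rw [hc.mem_freeCurves_iff ha]
    cases k <;> simp [CurveKind.missing]
  have hfin : ∀ (k : CurveKind) (T : Set (Set M.Dart)), (Prod.mk k '' T).Finite :=
    fun k T => (Set.toFinite T).image _
  rw [h, Set.ncard_union_eq _ ((hfin _ _).union (hfin _ _)) (hfin _ _),
    Set.ncard_union_eq _ (hfin _ _) (hfin _ _), Set.ncard_image_of_injective _ (hinj _),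
    Set.ncard_image_of_injective _ (hinj _), Set.ncard_image_of_injective _ (hinj _)]
  · rw [Set.disjoint_left]
    rintro _ ⟨S, -, rfl⟩ ⟨S', -, h⟩
    simp at h
  · rw [Set.disjoint_left]
    rintro _ (⟨S, -, rfl⟩ | ⟨S, -, rfl⟩) ⟨S', -, h⟩ <;> simp at h

/-- In an uncolorable graph, the ends of the edge of `a` are not on the same curve. -/
lemma IsPotential.not_reflTransGen (hc : IsPotential a c)
    (ha : ¬ M.SameVertex a (M.edge a)) (hM : ¬ M.IsColorable) {m : Klein} (hm : m ≠ 0) :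
    ¬ Relation.ReflTransGen (Linked (Bd (Region c m))) (M.rot a) (M.rot (M.edge a)) := by
  intro h
  have he : Bd (Region c m) = fun d => c d + c (M.edge d) ≠ 0 ∧ c d + c (M.edge d) ≠ m := by
    funext d
    exact propext (bd_region_iff hm)
  rw [he] at h
  exact hM (isColorable_of_reflTransGen ha (fun d => by rw [M.edge_edge, add_comm])
    hc.flow_eq_zero hc.flow_sum hm h)

lemma IsPotential.not_bd_of_isOnEdge (hc : IsPotential a c) {m : Klein} (hm : m ≠ 0) {b : M.Dart}
    (hb : M.IsOnEdge a b) : ¬ Bd (Region c m) b := fun h =>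
  ((bd_region_iff hm).1 h).1 ((hc.flow_eq_zero b).2 hb)

lemma IsPotential.bd_rot_rot_iff (hc : IsPotential a c) {m : Klein} {b : M.Dart}
    (hb : M.IsOnEdge a b) : Bd (Region c m) (M.rot (M.rot b)) ↔ Bd (Region c m) (M.rot b) := by
  have h1 : Region c m b := Or.inl (hc.eq_zero hb)
  have h2 : Region c m (M.rot b) := Or.inl (hc.rot_eq_zero hb)
  unfold Bd
  rw [← region_rot hc.face, ← region_rot hc.face, M.rot_rot_rot]
  tauto

lemma ncard_isOnEdge : {b | M.IsOnEdge a b}.ncard = 2 :=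
  Set.ncard_eq_two.2 ⟨a, M.edge a, (M.edge_ne a).symm, rfl⟩

/-- Each end of the edge of `a` is either on a curve or inside the region. -/
theorem IsPotential.numWalks_eq (hc : IsPotential a c)
    (ha : ¬ M.SameVertex a (M.edge a)) (hM : ¬ M.IsColorable) {m : Klein} (hm : m ≠ 0) :
    numWalks (Region c m) (region_rot hc.face) =
      (freeSets a (Bd (Region c m))).ncard + 2 := by
  classical
  set s := Region c m with hs
  set E : Set M.Dart := {b | M.IsOnEdge a b ∧ ¬ Bd s (M.rot b)} with hE
  set E' : Set M.Dart := {b | M.IsOnEdge a b ∧ Bd s (M.rot b)} with hE'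
  have hsv : ∀ b, M.IsOnEdge a b → ∀ b', M.IsOnEdge a b' → M.SameVertex b b' → b = b' := by
    rintro b (rfl | rfl) b' (rfl | rfl) h
    · rfl
    · exact (ha h).elim
    · exact (ha h.symm).elim
    · rfl
  have hEE : E'.ncard + E.ncard = 2 := by
    rw [← ncard_isOnEdge (a := a), ← Set.ncard_union_eq _ (Set.toFinite _) (Set.toFinite _)]
    · congr 1
      ext b
      simp only [hE, hE', Set.mem_union, Set.mem_ofPred_eq, ← and_or_left, em, and_true]
    · rw [Set.disjoint_left]
      exact fun b h h' => h'.2 h.2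
  set curve : M.Dart → Set M.Dart := fun d => {d' | Relation.ReflTransGen (Linked (Bd s)) d d'}
    with hcurve
  have hthrough : curveSets (Bd s) = freeSets a (Bd s) ∪ (fun b => curve (M.rot b)) '' E' := by
    ext S
    constructor
    · intro hS
      by_cases h : ∀ d ∈ S, ¬ M.IsAtEnd a d
      · exact Or.inl ⟨hS, h⟩
      · push Not at h
        obtain ⟨e, heS, he⟩ := h
        obtain ⟨d, hd, rfl⟩ := hS
        have heb : Bd s e := linked_of_reflTransGen hd heS
        obtain ⟨b, hb, -, -, h3⟩ := he.exists_eq ha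
        have hbr : Bd s (M.rot b) := by
          rcases h3 with rfl | rfl | rfl
          · exact (hc.not_bd_of_isOnEdge hm hb heb).elim
          · exact heb
          · exact (hc.bd_rot_rot_iff hb).1 heb
        refine Or.inr ⟨b, ⟨hb, hbr⟩, ?_⟩
        refine setOf_reflTransGen_eq_iff.2 (reflTransGen_linked_symm ?_)
        have hev : M.SameVertex e (M.rot b) :=
          (SameVertex.symm (sameVertex_iff.2 h3)).trans (sameVertex_rot b)
        exact heS.tail ⟨heb, hbr, Or.inr hev⟩
    · rintro (h | ⟨b, hb, rfl⟩)
      · exact h.1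
      · exact ⟨M.rot b, hb.2, rfl⟩
  -- Uncolorability enters here: curves through different ends are different. Hence each end adds
  -- exactly one walk, whether a boundary curve or a walk around it.
  have hinj : Set.InjOn (fun b => curve (M.rot b)) E' := by
    intro b hb b' hb' h
    have h' := setOf_reflTransGen_eq_iff.1 h
    have hn := hc.not_reflTransGen ha hM hm
    rcases hb.1 with rfl | rfl <;> rcases hb'.1 with rfl | rfl
    · rfl
    · exact (hn h').elim
    · exact (hn (reflTransGen_linked_symm h')).elim
    · rfl
  have hdisj : Disjoint (freeSets a (Bd s)) ((fun b => curve (M.rot b)) '' E') := by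
    rw [Set.disjoint_left]
    rintro _ h ⟨b, hb, rfl⟩
    exact h.2 (M.rot b) .refl (isAtEnd_rot.2 hb.1.isAtEnd)
  rw [CubicMap.numWalks_eq (region_rot hc.face) E, hthrough,
    Set.ncard_union_eq hdisj (Set.toFinite _) (Set.toFinite _), hinj.ncard_image, add_assoc, hEE]
  · rintro b ⟨hb, hb'⟩
    exact ⟨Or.inl (hc.eq_zero hb), hc.not_bd_of_isOnEdge hm hb, hb'⟩
  · exact fun b hb b' hb' h => hsv b hb.1 b' hb'.1 h
  -- Away from `a` the three flow values at a vertex are nonzero and distinct, so at most one of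
  -- them is `m`, and the vertex cannot be interior to the region.
  · intro d hd h1 h2
    rw [bd_region_iff hm] at h1 h2
    have hend : M.IsAtEnd a d := by
      by_contra hend
      have n0 : c d + c (M.edge d) ≠ 0 := fun h =>
        not_isOnEdge_of_not_isAtEnd hend ((hc.flow_eq_zero d).1 h)
      have n1 : c (M.rot d) + c (M.edge (M.rot d)) ≠ 0 := fun h =>
        not_isOnEdge_of_not_isAtEnd (mt isAtEnd_rot.1 hend) ((hc.flow_eq_zero _).1 h)
      have n2 : c (M.rot (M.rot d)) + c (M.edge (M.rot (M.rot d))) ≠ 0 := fun h =>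
        not_isOnEdge_of_not_isAtEnd (mt isAtEnd_rot.1 (mt isAtEnd_rot.1 hend))
          ((hc.flow_eq_zero _).1 h)
      have hne := Klein.ne_of_add_eq_zero (hc.flow_sum d) n2
      have e0 : c d + c (M.edge d) = m := by tauto
      have e1 : c (M.rot d) + c (M.edge (M.rot d)) = m := by tauto
      exact hne (e0.trans e1.symm)
    obtain ⟨b, hb, -, -, h3⟩ := hend.exists_eq ha
    refine ⟨b, ⟨hb, ?_⟩, sameVertex_iff.2 h3⟩
    rw [← bd_region_iff hm] at h1 h2
    rcases h3 with rfl | rfl | rfl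
    · exact h2
    · exact h1
    · rwa [hc.bd_rot_rot_iff hb] at h1

/-- Parity of the number of curves. -/
theorem IsPotential.even_ncard_freeCurves_add (hc : IsPotential a c)
    (ha : ¬ M.SameVertex a (M.edge a)) (hM : ¬ M.IsColorable) {c' : M.Dart → Klein}
    (hc' : IsPotential a c') (h0 : ∀ d, c' d = 0 ↔ c d = 0) :
    Even ((hc.formation ha).freeCurves.ncard + (hc'.formation ha).freeCurves.ncard) := by
  have h := hc.even_numWalks_add hc' h0
  rw [hc.numWalks_eq ha hM (by decide), hc.numWalks_eq ha hM (by decide),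
    hc.numWalks_eq ha hM (by decide), hc'.numWalks_eq ha hM (by decide),
    hc'.numWalks_eq ha hM (by decide), hc'.numWalks_eq ha hM (by decide)] at h
  rw [hc.ncard_freeCurves ha, hc'.ncard_freeCurves ha]
  rw [Nat.even_iff] at h ⊢
  omega

end CubicMap

/-! ### The trail that is not prime. -/

/-- For renaming the colors so that `w` becomes blue. -/
lemma Klein.exists_addMonoidHom {w : Klein} (hw : w ≠ 0) :
    ∃ ρ : Klein →+ Klein, Function.Injective ρ ∧ ρ w = (0, 1) := by
  have hcases : ∀ x : Klein, x ≠ 0 → x = (1, 0) ∨ x = (0, 1) ∨ x = (1, 1) := by decide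
  rcases hcases w hw with rfl | rfl | rfl
  · exact ⟨(AddEquiv.prodComm (M := ZMod 2) (N := ZMod 2)).toAddMonoidHom,
      AddEquiv.injective _, rfl⟩
  · exact ⟨AddMonoidHom.id _, Function.injective_id, rfl⟩
  · refine ⟨⟨⟨fun x => (x.1 + x.2, x.2), rfl⟩, fun x y => ?_⟩, ?_, ?_⟩
    · revert x y
      decide
    · change ∀ x y : Klein, (x.1 + x.2, x.2) = (y.1 + y.2, y.2) → x = y
      decide
    · change ((1 + 1, 1) : Klein) = (0, 1)
      decide

namespace CubicMap

variable {M : CubicMap} {a : M.Dart} {c : M.Dart → Klein}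

lemma IsOnEdge.not_isOnEdge_rot (ha : ¬ M.SameVertex a (M.edge a)) {b : M.Dart}
    (hb : M.IsOnEdge a b) : ¬ M.IsOnEdge a (M.rot b) := by
  intro h
  have hs := sameVertex_rot b
  rcases hb with rfl | rfl <;> rcases h with h | h
  · exact M.rot_ne _ h
  · exact ha (h ▸ hs)
  · exact ha (h ▸ hs).symm
  · exact M.rot_ne _ h

/-- Otherwise only the two ends of `a` exist, and they are joined by three edges. Blue on the two
edges other than `a` puts both ends on one curve, which yields a coloring. So the reduced graph is
not empty. -/
lemma exists_not_isAtEnd (ha : ¬ M.SameVertex a (M.edge a))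
    (hl : ∀ d, ¬ M.SameVertex d (M.edge d)) (hM : ¬ M.IsColorable) : ∃ d, ¬ M.IsAtEnd a d := by
  classical
  by_contra! hall
  apply hM
  obtain ⟨k, hk⟩ : ∃ k : M.Dart → Klein, ∀ d, k d = if M.IsOnEdge a d then 0 else (0, 1) :=
    ⟨_, fun _ => rfl⟩
  have k1 : ∀ d, M.IsOnEdge a d → k d = 0 := fun d h => by rw [hk, if_pos h]
  have k2 : ∀ d, ¬ M.IsOnEdge a d → k d = (0, 1) := fun d h => by rw [hk, if_neg h]
  have hra := IsOnEdge.not_isOnEdge_rot ha (Or.inl rfl)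
  have hC : ∀ d, ¬ M.IsOnEdge a d → k d ≠ 0 ∧ k d ≠ (1, 0) := fun d hd => by
    rw [k2 d hd]
    decide
  refine isColorable_of_reflTransGen (k := k) (m := (1, 0)) ha (fun d => ?_) (fun d => ?_)
    (fun d => ?_) (by decide) ?_
  · simp only [hk, isOnEdge_edge]
  · exact ⟨fun h => by_contra fun h' => (hC d h').1 h, k1 d⟩
  · obtain ⟨b, hb, hb1, hb2, rfl | rfl | rfl⟩ := (hall d).exists_eq ha <;>
      simp only [M.rot_rot_rot, k1 _ hb, k2 _ hb1, k2 _ hb2] <;> decide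
  · have hend : M.SameVertex (M.edge (M.rot a)) (M.rot (M.edge a)) := by
      have h := (hall (M.edge (M.rot a))).resolve_left fun h =>
        hl _ ((sameVertex_rot a).symm.trans h)
      exact h.symm.trans (sameVertex_rot _)
    have he : ¬ M.IsOnEdge a (M.edge (M.rot a)) := mt isOnEdge_edge.1 hra
    exact (Relation.ReflTransGen.single ⟨hC _ hra, hC _ he, Or.inl rfl⟩).tail
      ⟨hC _ he, hC _ (IsOnEdge.not_isOnEdge_rot ha (Or.inr rfl)), Or.inr hend⟩

lemma IsPotential.map (hc : IsPotential a c) {ρ : Klein →+ Klein} (hρ : Function.Injective ρ) :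
    IsPotential a fun d => ρ (c d) where
  face d := by rw [hc.face]
  eq_iff d := by rw [hρ.eq_iff, hc.eq_iff]
  base := by rw [hc.base, map_zero]

/-- There is a formation in which both endpoints of the empty edge are blue. -/
lemma IsPotential.exists_blue (hc : IsPotential a c) (ha : ¬ M.SameVertex a (M.edge a))
    (hM : ¬ M.IsColorable) (hB : M.CyclesBound) : ∃ c', IsPotential a c' ∧
      ∀ b, M.IsOnEdge a b → c' (M.rot b) + c' (M.edge (M.rot b)) = (0, 1) := by
  have hn : ∀ {c : M.Dart → Klein} (_ : IsPotential a c) b, M.IsOnEdge a b →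
      c (M.rot b) + c (M.edge (M.rot b)) ≠ 0 := by
    exact fun hc b hb h => hb.not_isOnEdge_rot ha ((hc.flow_eq_zero _).1 h)
  obtain ⟨c1, hc1, h1⟩ : ∃ c', IsPotential a c' ∧ c' (M.rot a) + c' (M.edge (M.rot a)) =
      c' (M.rot (M.edge a)) + c' (M.edge (M.rot (M.edge a))) := by
    by_cases heq : c (M.rot a) + c (M.edge (M.rot a)) =
        c (M.rot (M.edge a)) + c (M.edge (M.rot (M.edge a)))
    · exact ⟨c, hc, heq⟩
    have hu := hn hc a (Or.inl rfl)
    have hv := hn hc _ (Or.inr rfl)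
    -- With `m` the sum of the two different contextual colors, the curves avoiding `m` carry just
    -- these two colors, and a Kempe change at the first end turns its color into the other one.
    obtain ⟨m, hmdef⟩ : ∃ m, m = c (M.rot a) + c (M.edge (M.rot a)) +
      (c (M.rot (M.edge a)) + c (M.edge (M.rot (M.edge a)))) := ⟨_, rfl⟩
    have hm : ∀ u v : Klein, u ≠ 0 → v ≠ 0 → u ≠ v → u + v ≠ 0 ∧ u ≠ u + v ∧
      u + (u + v) = v := by decide
    obtain ⟨hm0, hm1, hm2⟩ := hm _ _ hu hv heq
    rw [← hmdef] at hm0 hm1 hm2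
    obtain ⟨c', hc', -, e1, e2⟩ := hc.exists_shift hB hm0 ((bd_region_iff hm0).2 ⟨hu, hm1⟩)
      (hc.not_reflTransGen ha hM hm0)
    exact ⟨c', hc', by rw [e1, e2, hm2]⟩
  obtain ⟨ρ, hρ, hw⟩ := Klein.exists_addMonoidHom (hn hc1 a (Or.inl rfl))
  refine ⟨_, hc1.map hρ, ?_⟩
  rintro b (rfl | rfl)
  · rw [← map_add, hw]
  · rw [← map_add, ← h1, hw]

/-- If the contextual curves of a formation for an uncolorable plane graph are blue, and it has
a red curve, then some formation is factored. -/
lemma IsPotential.exists_isFactored (hc : IsPotential a c) (ha : ¬ M.SameVertex a (M.edge a))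
    (hM : ¬ M.IsColorable) (hB : M.CyclesBound)
    (hblue : ∀ b, M.IsOnEdge a b → c (M.rot b) + c (M.edge (M.rot b)) = (0, 1))
    (hred : ∃ d, (hc.formation ha).Carries .red d) : ∃ F : Formation M a, F.IsFactored := by
  have hb1 := hblue a (Or.inl rfl)
  have hb2 := hblue _ (Or.inr rfl)
  have hm : ((1, 0) : Klein) ≠ 0 := by decide
  -- Adding red on the blue curve at the tail makes the tail purple and leaves the head blue.
  obtain ⟨c', hc', h0, e1, e2⟩ := hc.exists_shift hB hm
    ((bd_region_iff hm).2 (by rw [hb1]; decide)) (hc.not_reflTransGen ha hM hm)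
  have hev := hc.even_ncard_freeCurves_add ha hM hc' h0
  have hne : ¬ (hc'.formation ha).SameContextColor := by
    rw [Formation.SameContextColor, hc'.formation_color ha, hc'.formation_color ha, e1, e2, hb1,
      hb2]
    intro h
    exact absurd (Klein.toColor_injective (by decide) (by decide) h) (by decide)
  have heq : (hc.formation ha).SameContextColor := by
    rw [Formation.SameContextColor, hc.formation_color ha, hc.formation_color ha, hb1, hb2]
  obtain ⟨d, hd⟩ := hred
  -- Red curves avoid blue edges, and both endpoints of the empty edge are on blue edges, so every
  -- red curve is free.
  have hend : ∀ d, Bd (Region c (0, 1)) d → ¬ M.IsAtEnd a d := by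
    intro d hd h
    have hm' : ((0, 1) : Klein) ≠ 0 := by decide
    obtain ⟨b, hb, -, -, rfl | rfl | rfl⟩ := h.exists_eq ha
    · exact hc.not_bd_of_isOnEdge hm' hb hd
    · exact ((bd_region_iff hm').1 hd).2 (hblue b hb)
    · rw [hc.bd_rot_rot_iff hb] at hd
      exact ((bd_region_iff hm').1 hd).2 (hblue b hb)
  have hbd := (hc.carries_iff ha .red d).1 hd
  have hfree : (hc.formation ha).freeCurves.Nonempty := by
    refine ⟨(.red, (hc.formation ha).curveThrough .red d), ⟨d, hd, rfl⟩, fun d' hd' => ?_⟩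
    rw [hc.curveThrough_eq] at hd'
    exact hend d' (linked_of_reflTransGen hbd hd')
  by_contra! hF
  have n1 : (hc'.formation ha).freeCurves = ∅ :=
    Set.not_nonempty_iff_eq_empty.1 fun h => hF _ (Or.inr ⟨hne, h⟩)
  have n2 : (hc.formation ha).freeCurves.Subsingleton :=
    Set.not_nontrivial_iff.1 fun h => hF _ (Or.inl ⟨heq, h⟩)
  -- One free curve before the change and none after it contradict the parity.
  obtain ⟨C, hC⟩ := hfree
  rw [n1, n2.eq_singleton_of_mem hC, Set.ncard_empty, Set.ncard_singleton] at hev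
  exact absurd hev (by decide)

/-- Two edges at a remaining vertex cannot both be blue. -/
lemma IsPotential.exists_carries_red (hc : IsPotential a c) (ha : ¬ M.SameVertex a (M.edge a))
    {d : M.Dart} (hd : ¬ M.IsAtEnd a d) : ∃ d, (hc.formation ha).Carries .red d := by
  have n0 : ∀ d, ¬ M.IsAtEnd a d → c d + c (M.edge d) ≠ 0 := fun d hd h =>
    not_isOnEdge_of_not_isAtEnd hd ((hc.flow_eq_zero d).1 h)
  have hd1 : ¬ M.IsAtEnd a (M.rot d) := mt isAtEnd_rot.1 hd
  have hne := Klein.ne_of_add_eq_zero (hc.flow_sum d) (n0 _ (mt isAtEnd_rot.1 hd1))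
  simp only [hc.carries_iff ha, bd_region_iff CurveKind.red.missing_ne]
  by_cases h : c d + c (M.edge d) = CurveKind.red.missing
  · exact ⟨M.rot d, n0 _ hd1, fun h' => hne (h.trans h'.symm)⟩
  · exact ⟨d, n0 _ hd, h⟩

/-- A smallest uncolorable plane graph without isthmus is the graph of a trail that is not prime. -/
theorem IsSmallestPlaneUncolorable.exists_trail (hM : M.IsSmallestPlaneUncolorable) :
    ∃ T : Trail, T.graph = M ∧ T.IsNonempty ∧ T.Factorizes := by
  obtain ⟨⟨hp, hi, hcol⟩, hmin⟩ := hM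
  have hl := hi.not_sameVertex_edge
  obtain ⟨a, hr⟩ := exists_isRemovable hp.1 hi
  have ha := hl a
  obtain ⟨N, v, hD⟩ := exists_isDeletion ha hl
  obtain ⟨d, hd⟩ := exists_not_isAtEnd ha hl hcol
  have hne : Nonempty N.Dart := ⟨(hD.exists_eq d hd).choose⟩
  have hN : N.IsColorable := by
    by_contra h
    exact absurd (hmin N (hD.isConnectedPlane ha hl hp (hi a) hne)
      (hD.withoutIsthmus ha hl hr) h) hD.numVertices_lt.not_ge
  obtain ⟨f, he, h0, hv⟩ := hN.exists_flow
  -- The choice of `S` keeps the extended flow nonzero off `a`, also on circles without vertices.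
  obtain ⟨k, -, ke, k0, k1, kv⟩ := hD.exists_flow_extension ha hl Klein.add_self
    (S := {x | x ≠ 0}) ⟨(0, 1), by decide⟩ f h0 he hv
  have hB := hp.1.isConnectedPlane_iff.1 hp
  obtain ⟨c0, hc0, -⟩ := exists_isPotential (a := a) hB ke
    (fun d => ⟨fun h => by_contra fun h' => k1 d h' h, k0 d⟩) kv
  obtain ⟨c, hc, hblue⟩ := hc0.exists_blue ha hcol hB
  have hred := hc.exists_carries_red ha hd
  have hcolor : ∀ b, M.IsOnEdge a b → (hc.formation ha).color (M.rot b) = .blue := fun b hb => by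
    rw [hc.formation_color ha, hblue b hb]
    rfl
  refine ⟨⟨M, a, ha, hc.formation ha, hcolor a (Or.inl rfl), hcolor _ (Or.inr rfl), ?_⟩, rfl, hred,
    hc.exists_isFactored ha hcol hB hblue hred⟩
  rw [hc.curveThrough_eq, hc.curveThrough_eq, Ne, setOf_reflTransGen_eq_iff]
  exact hc.not_reflTransGen ha hcol (CurveKind.missing_ne _)

lemma exists_isSmallestPlaneUncolorable (h : ¬ FourColorTheorem) :
    ∃ M : CubicMap, M.IsSmallestPlaneUncolorable := by
  simp only [FourColorTheorem, not_forall] at h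
  obtain ⟨M, hp, hi, hcol⟩ := h
  obtain ⟨N, hN, hmin⟩ := (measure numVertices).wf.has_min
    {M : CubicMap | M.IsConnectedPlane ∧ M.WithoutIsthmus ∧ ¬ M.IsColorable} ⟨M, hp, hi, hcol⟩
  exact ⟨N, hN, fun N' h1 h2 h3 => not_lt.1 (hmin N' ⟨h1, h2, h3⟩)⟩

end CubicMap

theorem mainTheorem1 : PrimalityPrinciple ↔ FourColorTheorem := by
  constructor
  · intro hP
    by_contra h
    obtain ⟨M, hM⟩ := CubicMap.exists_isSmallestPlaneUncolorable h
    obtain ⟨T, rfl, hne, hF⟩ := hM.exists_trail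
    exact hP T hM.1.1 hne hM.1.2.2 hM hF
  · intro hF T hp _ hu hm
    exact (hu (hF T.graph hp hm.1.2.1)).elim
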